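/- For $n\in\mathbb N$ we work in Euclidean $\mathbb R^n$. A \emph{curve} is a continuous map $\gamma\colon[a,b]\to\mathbb R^n$ on a compact interval, with trace $|\gamma|=\gamma([a,b])$. A \emph{continuum} is a compact connected set; a set is \emph{non-degenerate} if it has more than one point. The $n$-modulus of a family $\Gamma$ of curves in $\mathbb R^n$ is $\operatorname{Mod}_n\Gamma=\inf_\rho\int_{\mathbb R^n}\rho^n\,dx$, where the infimum is over all Borel functions $\rho\colon\mathbb R^n\to[0,\infty]$ with $\int_\gamma\rho\,ds\ge 1$ for every rectifiable $\gamma\in\Gamma$ (line integral with respect to arclength), and is $\infty$ if there is no such $\rho$. For $F_1,F_2\subset\mathbb R^n$ let $\Gamma(F_1,F_2;\mathbb R^n)$ be the family of curves $\gamma\colon[a,b]\to\mathbb R^n$ with $\gamma(a)\in F_1$ and $\gamma(b)\in F_2$. For $E\subset\mathbb R^n$ let $\mathcal F_0(E)$ be the family of curves $\gamma\colon[a,b]\to\mathbb R^n$ for which $|\gamma|\setminus\{\gamma(a),\gamma(b)\}$ does not intersect $E$, and let $\mathcal F_\sigma(E)$ be the family of curves $\gamma$ for which $E\cap|\gamma|$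 is countable (finite or infinite). We write $E\in\mathrm{NED}$ (resp. $E\in\mathrm{CNED}$) if, for every pair of non-empty, disjoint continua $F_1,F_2\subset\mathbb R^n$, $$\operatorname{Mod}_n\Gamma(F_1,F_2;\mathbb R^n)=\operatorname{Mod}_n\big(\Gamma(F_1,F_2;\mathbb R^n)\cap\mathcal F_0(E)\big)\quad\Big(\text{resp. }\operatorname{Mod}_n\Gamma(F_1,F_2;\mathbb R^n)=\operatorname{Mod}_n\big(\Gamma(F_1,F_2;\mathbb R^n)\cap\mathcal F_\sigma(E)\big)\Big).$$ The relative distance of two non-degenerate continua is $$\Delta(F_1,F_2)=\frac{\operatorname{dist}(F_1,F_2)}{\min\{\operatorname{diam}F_1,\operatorname{diam}F_2\}}.$$ \textbf{Theorem 1.10.} Let $E\subset\mathbb R^n$ be a closed set. Then $E\in\mathrm{NED}$ (resp. $E\in\mathrm{CNED}$) if and only if there exists a function $\phi\colon(0,\infty)\to(0,\infty)$ such that for each $t>0$ and for every pair of non-degenerate, disjoint continua $F_1,F_2\subset\mathbb R^n$ with $\Delta(F_1,F_2)\le t$ we have $$\operatorname{Mod}_n\big(\Gamma(F_1,F_2;\mathbb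 R^n)\cap\mathcal F_0(E)\big)\ge\phi(t)\qquad\Big(\text{resp. }\operatorname{Mod}_n\big(\Gamma(F_1,F_2;\mathbb R^n)\cap\mathcal F_\sigma(E)\big)\ge\phi(t)\Big).$$ -/

import Mathlib

open MeasureTheory Set
open scoped ENNReal

namespace ExtremalDistance

/-- A curve (path) in `ℝⁿ`: a continuous map defined on a compact interval `[a, b]`.
Only the values of `toFun` on `[a, b]` are ever used. -/
structure Curve (n : ℕ) where
  a : ℝ
  b : ℝ
  le : a ≤ b
  toFun : ℝ → EuclideanSpace ℝ (Fin n)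
  continuousOn : ContinuousOn toFun (Icc a b)

namespace Curve

variable {n : ℕ}

/-- The trace `|γ| = γ([a, b])`. -/
def trace (γ : Curve n) : Set (EuclideanSpace ℝ (Fin n)) :=
  γ.toFun '' Icc γ.a γ.b

/-- The set of endpoints `∂γ = {γ(a), γ(b)}`. -/
def endpoints (γ : Curve n) : Set (EuclideanSpace ℝ (Fin n)) :=
  {γ.toFun γ.a, γ.toFun γ.b}

/-- The length of a curve: its total variation on `[a, b]`. -/
noncomputable def length (γ : Curve n) : ℝ≥0∞ :=
  eVariationOn γ.toFun (Icc γ.a γ.b)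

/-- A curve is rectifiable if its length is finite. -/
def Rectifiable (γ : Curve n) : Prop :=
  γ.length ≠ ∞

/-- The arclength parametrization `[0, ℓ(γ)] → ℝⁿ` of a rectifiable curve: its value at the
variation of `γ` on `[a, s]` is `γ(s)`, for every `s ∈ [a, b]`. -/
noncomputable def arclengthParam (γ : Curve n) : ℝ → EuclideanSpace ℝ (Fin n) :=
  naturalParameterization γ.toFun (Icc γ.a γ.b) γ.a

/-- The line integral `∫_γ ρ ds`, for a rectifiable curve `γ`, defined through the arclength
parametrization. -/
noncomputable def lineIntegral (γ : Curve n) (ρ : EuclideanSpace ℝ (Fin n) → ℝ≥0∞) : ℝ≥0∞ :=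
  ∫⁻ t in Icc (0 : ℝ) γ.length.toReal, ρ (γ.arclengthParam t)

end Curve

/-- A Borel function `ρ : ℝⁿ → [0, ∞]` is admissible for a curve family `Γ` if `∫_γ ρ ds ≥ 1`
for all rectifiable `γ ∈ Γ`. -/
def Admissible {n : ℕ} (Γ : Set (Curve n)) (ρ : EuclideanSpace ℝ (Fin n) → ℝ≥0∞) : Prop :=
  Measurable ρ ∧ ∀ γ ∈ Γ, γ.Rectifiable → 1 ≤ γ.lineIntegral ρ

/-- The (conformal) `n`-modulus of a curve family in `ℝⁿ`: the infimum of `∫ ρⁿ` over all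
admissible `ρ`, which is `∞` if there are none. -/
noncomputable def modulus {n : ℕ} (Γ : Set (Curve n)) : ℝ≥0∞ :=
  ⨅ (ρ : EuclideanSpace ℝ (Fin n) → ℝ≥0∞) (_ : Admissible Γ ρ), ∫⁻ x, ρ x ^ n

/-- `Γ(F₁, F₂; U)`: the curves `γ : [a, b] → closure U` with `γ(a) ∈ F₁`, `γ(b) ∈ F₂` and
`γ((a, b)) ⊆ U`. -/
def joining {n : ℕ} (F₁ F₂ U : Set (EuclideanSpace ℝ (Fin n))) : Set (Curve n) :=
  {γ | γ.trace ⊆ closure U ∧ γ.toFun γ.a ∈ F₁ ∧ γ.toFun γ.b ∈ F₂ ∧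
    γ.toFun '' Ioo γ.a γ.b ⊆ U}

/-- `𝓕₀(E)`: the curves that do not intersect `E`, except possibly at the endpoints. -/
def avoiding {n : ℕ} (E : Set (EuclideanSpace ℝ (Fin n))) : Set (Curve n) :=
  {γ | Disjoint (γ.trace \ γ.endpoints) E}

/-- `𝓕_σ(E)`: the curves that intersect `E` at countably many (possibly finitely many) points. -/
def meetingCountably {n : ℕ} (E : Set (EuclideanSpace ℝ (Fin n))) : Set (Curve n) :=
  {γ | (E ∩ γ.trace).Countable}

/-- A (non-empty) continuum: a non-empty compact connected set. Single points are allowed. -/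
def IsContinuum {n : ℕ} (F : Set (EuclideanSpace ℝ (Fin n))) : Prop :=
  IsCompact F ∧ IsConnected F

/-- `E` is negligible for extremal distances. -/
def NED {n : ℕ} (E : Set (EuclideanSpace ℝ (Fin n))) : Prop :=
  ∀ F₁ F₂ : Set (EuclideanSpace ℝ (Fin n)), IsContinuum F₁ → IsContinuum F₂ → Disjoint F₁ F₂ →
    modulus (joining F₁ F₂ univ) = modulus (joining F₁ F₂ univ ∩ avoiding E)

/-- `E` is negligible for extremal distances with countable intersections. -/
def CNED {n : ℕ} (E : Set (EuclideanSpace ℝ (Fin n))) : Prop :=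
  ∀ F₁ F₂ : Set (EuclideanSpace ℝ (Fin n)), IsContinuum F₁ → IsContinuum F₂ → Disjoint F₁ F₂ →
    modulus (joining F₁ F₂ univ) = modulus (joining F₁ F₂ univ ∩ meetingCountably E)

/-- The relative distance `Δ(F₁, F₂) = dist(F₁, F₂) / min {diam F₁, diam F₂}`, used only for
non-degenerate compact sets, for which the denominator is positive and finite. -/
noncomputable def relativeDistance {n : ℕ} (F₁ F₂ : Set (EuclideanSpace ℝ (Fin n))) : ℝ :=
  sInf (image2 dist F₁ F₂) / min (Metric.diam F₁) (Metric.diam F₂)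

end ExtremalDistance

/-!
Let a "good" curve be one whose interior avoids `E` (respectively meets `E` in a countable set).
Line integrals are handled through `1`-Lipschitz paths: arclength parametrization turns a
rectifiable curve into such a path, and the line integral along a `1`-Lipschitz path is at most
the integral with respect to the parameter, so the modulus does not change
(`modulus_eq_lipModulus`). Both notions of goodness are instances of an ideal of sets
(`IsNegligibleIdeal`), and are treated together.

If good curves suffice for the modulus, then the lower bound is the Loewner property of `ℝⁿ`
(`loewner`). By the Vitali covering lemma each non-degenerate continuum contains a point around
which the mass of `ρ ^ n` decays linearly in the radius, and for two such points the integrals of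
`ρ` over the broken lines joining them through a third point are small on average
(`lintegral_cost_segmentPath_le`).

Conversely, suppose that the good curves satisfy a Loewner-type bound, that `ρ` is admissible for
the good curves, and that `n ≥ 2`. First, `E` is a null set, because at a density point `E` leaves
too little room for good curves (`HasLoewnerBound.volume_eq_zero`). Next, curves escaping from a
ball to a much larger one have small modulus, so the bound can be localized: continua of size `r`
at distance comparable to `r` are joined by a good curve nearby along which the integral of `ρ` is
at most a constant times the `Lⁿ` norm of `ρ` on a ball of radius comparable to `r`
(`HasLoewnerBound.exists_lipPath`). Now an arbitrary path is cut into pieces of diameter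
comparable to `r`; the pieces close to `E` are replaced by small good paths, and these are chained
together by further ones (`HasLinks.exists_lipPath_aux`). The additional cost is at most the
integral along the original path of a function `2 G`, up to a small error for the two ends, where
`G` is an `Lⁿ` average of `ρ` at scale `r` over points close to `E`. Since `E` is a null set, the
norm of `G` tends to zero with `r`, and `ρ + 2 G`, divided by a number close to one, is admissible
for all curves (`HasLoewnerBound.exists_perturbation`). Hence the two moduli agree
(`HasLoewnerBound.lipModulus_eq`). For `n ≥ 2` both moduli vanish if one of the continua is a
point. On the line, the bound forces every path between disjoint continua to be good after
shortening (`lipModulus_le_of_dim_one`).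
-/

namespace ExtremalDistance

/-! ### One-Lipschitz paths -/

/-- A path parametrized with speed at most one on `[0, len]`. For convenience the
parametrization is defined, and `1`-Lipschitz, on all of `ℝ`. Every rectifiable curve has such a
parametrization, by arclength. Unit speed is not required, which makes these paths easy to extend
and to concatenate. -/
structure LipPath (n : ℕ) where
  len : ℝ
  len_nonneg : 0 ≤ len
  toFun : ℝ → EuclideanSpace ℝ (Fin n)
  lip : LipschitzWith 1 toFun

namespace LipPath

variable {n : ℕ} (c d : LipPath n)

def source : EuclideanSpace ℝ (Fin n) := c.toFun 0

def target : EuclideanSpace ℝ (Fin n) := c.toFun c.len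

def trace : Set (EuclideanSpace ℝ (Fin n)) := c.toFun '' Icc 0 c.len

/-- The part of the trace parametrized by the open interval. -/
def inner : Set (EuclideanSpace ℝ (Fin n)) := c.toFun '' Ioo 0 c.len

/-- The integral of `ρ` along the path with respect to the parameter. It is at least the line
integral with respect to arclength. -/
noncomputable def cost (ρ : EuclideanSpace ℝ (Fin n) → ℝ≥0∞) : ℝ≥0∞ :=
  ∫⁻ t in Ioc 0 c.len, ρ (c.toFun t)

lemma dist_le (s t : ℝ) : dist (c.toFun s) (c.toFun t) ≤ |s - t| := by
  simpa [Real.dist_eq] using c.lip.dist_le_mul s t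

lemma source_mem_trace : c.source ∈ c.trace := ⟨0, ⟨le_rfl, c.len_nonneg⟩, rfl⟩

lemma target_mem_trace : c.target ∈ c.trace := ⟨c.len, ⟨c.len_nonneg, le_rfl⟩, rfl⟩

lemma inner_subset_trace : c.inner ⊆ c.trace := image_mono Ioo_subset_Icc_self

lemma isContinuum_trace : IsContinuum c.trace :=
  ⟨isCompact_Icc.image c.lip.continuous,
    (isConnected_Icc c.len_nonneg).image _ c.lip.continuous.continuousOn⟩

lemma trace_subset : c.trace ⊆ insert c.source (insert c.target c.inner) := by
  rintro _ ⟨t, ⟨h0, h1⟩, rfl⟩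
  rcases h0.eq_or_lt with rfl | h0
  · exact Or.inl rfl
  rcases h1.eq_or_lt with rfl | h1
  · exact Or.inr (Or.inl rfl)
  · exact Or.inr (Or.inr ⟨t, ⟨h0, h1⟩, rfl⟩)

lemma cost_mono {ρ σ : EuclideanSpace ℝ (Fin n) → ℝ≥0∞} (h : ∀ x, ρ x ≤ σ x) :
    c.cost ρ ≤ c.cost σ := lintegral_mono fun _ => h _

/-- The part of the path between the parameters `s` and `t`. -/
def restrict (s t : ℝ) (h : s ≤ t) : LipPath n where
  len := t - s
  len_nonneg := sub_nonneg.2 h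
  toFun u := c.toFun (u + s)
  lip := by
    refine LipschitzWith.of_dist_le_mul fun u v => (c.dist_le _ _).trans_eq ?_
    simp [Real.dist_eq]

section restrict
variable {s t : ℝ} (h : s ≤ t)

@[simp] lemma source_restrict : (c.restrict s t h).source = c.toFun s := by
  simp [source, restrict]

@[simp] lemma target_restrict : (c.restrict s t h).target = c.toFun t := by
  simp [target, restrict]

@[simp] lemma trace_restrict : (c.restrict s t h).trace = c.toFun '' Icc s t := by
  have : (fun u => c.toFun (u + s)) = c.toFun ∘ (fun u => u + s) := rfl
  simp only [trace, restrict]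
  rw [this, image_comp]
  simp

@[simp] lemma inner_restrict : (c.restrict s t h).inner = c.toFun '' Ioo s t := by
  have : (fun u => c.toFun (u + s)) = c.toFun ∘ (fun u => u + s) := rfl
  simp only [inner, restrict]
  rw [this, image_comp]
  simp

lemma cost_restrict (ρ : EuclideanSpace ℝ (Fin n) → ℝ≥0∞) :
    (c.restrict s t h).cost ρ = ∫⁻ u in Ioc s t, ρ (c.toFun u) := by
  have := (measurePreserving_add_right (volume : Measure ℝ) s).setLIntegral_comp_preimage_emb
    (measurableEmbedding_addRight s) (fun u => ρ (c.toFun u)) (Ioc s t)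
  simpa [cost, restrict] using this

end restrict

/-- The path run backwards. -/
def reverse : LipPath n where
  len := c.len
  len_nonneg := c.len_nonneg
  toFun u := c.toFun (c.len - u)
  lip := by
    refine LipschitzWith.of_dist_le_mul fun u v => (c.dist_le _ _).trans_eq ?_
    simp [Real.dist_eq, abs_sub_comm]

@[simp] lemma source_reverse : c.reverse.source = c.target := by simp [source, target, reverse]

@[simp] lemma target_reverse : c.reverse.target = c.source := by simp [source, target, reverse]

@[simp] lemma trace_reverse : c.reverse.trace = c.trace := by
  have : (fun u => c.toFun (c.len - u)) = c.toFun ∘ (fun u => c.len - u) := rfl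
  simp only [trace, reverse]
  rw [this, image_comp]
  simp

@[simp] lemma cost_reverse (ρ : EuclideanSpace ℝ (Fin n) → ℝ≥0∞) :
    c.reverse.cost ρ = c.cost ρ := by
  have := (Measure.measurePreserving_sub_left (volume : Measure ℝ)
    c.len).setLIntegral_comp_preimage_emb
    (Homeomorph.subLeft c.len).measurableEmbedding (fun u => ρ (c.toFun u)) (Ioc 0 c.len)
  simp only [cost, reverse]
  rw [← this]
  simp only [preimage_const_sub_Ioc, sub_self, sub_zero]
  exact setLIntegral_congr Ico_ae_eq_Ioc.symm

/-- The path `c` followed by the path `d`, meaningful if `d` starts where `c` ends. -/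
def concat : LipPath n where
  len := c.len + d.len
  len_nonneg := add_nonneg c.len_nonneg d.len_nonneg
  toFun u := c.toFun (min u c.len) + (d.toFun (max (u - c.len) 0) - d.toFun 0)
  lip := by
    refine LipschitzWith.of_dist_le_mul fun s t => ?_
    wlog hst : s ≤ t generalizing s t
    · rw [dist_comm, dist_comm s]; exact this t s (le_of_not_ge hst)
    calc _ ≤ dist (c.toFun (min s c.len)) (c.toFun (min t c.len)) +
          dist (d.toFun (max (s - c.len) 0) - d.toFun 0)
            (d.toFun (max (t - c.len) 0) - d.toFun 0) := dist_add_add_le _ _ _ _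
      _ ≤ |min s c.len - min t c.len| + |max (s - c.len) 0 - max (t - c.len) 0| := by
          rw [dist_sub_right]
          exact add_le_add (c.dist_le _ _) (d.dist_le _ _)
      _ = (min t c.len - min s c.len) + (max (t - c.len) 0 - max (s - c.len) 0) := by
          rw [abs_sub_comm, abs_of_nonneg, abs_sub_comm, abs_of_nonneg]
          · exact sub_nonneg.2 (max_le_max (by linarith) le_rfl)
          · exact sub_nonneg.2 (min_le_min hst le_rfl)
      _ ≤ _ := by
          rw [dist_comm, Real.dist_eq, abs_of_nonneg (by linarith)]
          simp only [NNReal.coe_one, one_mul]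
          rcases le_total s c.len with h1 | h1 <;> rcases le_total t c.len with h2 | h2 <;>
            simp [h1, h2]

section concat
variable {c d}

lemma concat_apply_of_le {u : ℝ} (hu : u ≤ c.len) :
    (c.concat d).toFun u = c.toFun u := by
  simp [concat, hu]

lemma concat_apply_of_ge (h : c.target = d.source) {u : ℝ} (hu : c.len ≤ u) :
    (c.concat d).toFun u = d.toFun (u - c.len) := by
  simp only [source, target] at h
  simp [concat, hu, h]

lemma source_concat : (c.concat d).source = c.source :=
  concat_apply_of_le c.len_nonneg

lemma target_concat (h : c.target = d.source) : (c.concat d).target = d.target := by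
  have := concat_apply_of_ge h (u := c.len + d.len) (by linarith [d.len_nonneg])
  simpa [target, concat] using this

lemma cost_concat (h : c.target = d.source) (ρ : EuclideanSpace ℝ (Fin n) → ℝ≥0∞) :
    (c.concat d).cost ρ = c.cost ρ + d.cost ρ := by
  have hlen : (c.concat d).len = c.len + d.len := rfl
  have h1 : c.len ≤ c.len + d.len := by linarith [d.len_nonneg]
  rw [cost, hlen, ← Ioc_union_Ioc_eq_Ioc c.len_nonneg h1,
    lintegral_union measurableSet_Ioc (Ioc_disjoint_Ioc_of_le le_rfl)]
  congr 1
  · exact setLIntegral_congr_fun measurableSet_Ioc fun u hu => by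
      simp only [concat_apply_of_le hu.2]
  · have := (measurePreserving_sub_right (volume : Measure ℝ)
      c.len).setLIntegral_comp_preimage_emb
      (measurableEmbedding_subRight c.len) (fun u => ρ (d.toFun u)) (Ioc 0 d.len)
    rw [cost, ← this, preimage_sub_const_Ioc, zero_add, add_comm d.len]
    exact setLIntegral_congr_fun measurableSet_Ioc fun u hu => by
      simp only [concat_apply_of_ge h hu.1.le]

lemma image_concat_subset (h : c.target = d.source) {I J K : Set ℝ}
    (hJ : ∀ u ∈ I, u ≤ c.len → u ∈ J) (hK : ∀ u ∈ I, c.len < u → u - c.len ∈ K) :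
    (c.concat d).toFun '' I ⊆ c.toFun '' J ∪ d.toFun '' K := by
  rintro _ ⟨u, hu, rfl⟩
  rcases le_or_gt u c.len with h1 | h1
  · exact Or.inl ⟨u, hJ u hu h1, (concat_apply_of_le h1).symm⟩
  · exact Or.inr ⟨_, hK u hu h1, (concat_apply_of_ge h h1.le).symm⟩

lemma inner_concat_subset (h : c.target = d.source) :
    (c.concat d).inner ⊆ c.toFun '' Ioc 0 c.len ∪ d.toFun '' Ico 0 d.len :=
  image_concat_subset h (fun _ hu h1 => ⟨hu.1, h1⟩)
    fun u hu h1 => ⟨by linarith, by linarith [hu.2.trans_eq (show _ = c.len + d.len from rfl)]⟩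

end concat

/-- A path with distinct endpoints can be shortened so that its interior avoids the endpoints. -/
lemma exists_restrict_avoiding_endpoints (h : c.source ≠ c.target) :
    ∃ s t, 0 ≤ s ∧ s < t ∧ t ≤ c.len ∧ c.toFun s = c.source ∧ c.toFun t = c.target ∧
      ∀ u ∈ Ioo s t, c.toFun u ≠ c.source ∧ c.toFun u ≠ c.target := by
  have hc := c.lip.continuous
  -- `s` is the last time at the source and `t` the first time after `s` at the target.
  have hK : IsCompact (Icc 0 c.len ∩ c.toFun ⁻¹' {c.source}) :=
    isCompact_Icc.inter_right (isClosed_singleton.preimage hc)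
  obtain ⟨s, ⟨hs, hs1⟩, hsmax⟩ := hK.exists_isGreatest ⟨0, ⟨le_rfl, c.len_nonneg⟩, rfl⟩
  have hK' : IsCompact (Icc s c.len ∩ c.toFun ⁻¹' {c.target}) :=
    isCompact_Icc.inter_right (isClosed_singleton.preimage hc)
  obtain ⟨t, ⟨ht, ht1⟩, htmin⟩ := hK'.exists_isLeast ⟨c.len, ⟨hs.2, le_rfl⟩, rfl⟩
  simp only [mem_preimage, mem_singleton_iff] at hs1 ht1
  refine ⟨s, t, hs.1, lt_of_le_of_ne ht.1 ?_, ht.2, hs1, ht1,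
    fun u hu => ⟨fun h1 => ?_, fun h1 => ?_⟩⟩
  · rintro rfl
    exact h (hs1.symm.trans ht1)
  · exact absurd (hsmax ⟨⟨hs.1.trans hu.1.le, hu.2.le.trans ht.2⟩, h1⟩) (not_le.2 hu.1)
  · exact absurd (htmin ⟨⟨hu.1.le, hu.2.le.trans ht.2⟩, h1⟩) (not_le.2 hu.2)

lemma cost_restrict_le {s t : ℝ} (h : s ≤ t) (hs : 0 ≤ s) (ht : t ≤ c.len)
    (ρ : EuclideanSpace ℝ (Fin n) → ℝ≥0∞) : (c.restrict s t h).cost ρ ≤ c.cost ρ := by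
  rw [cost_restrict]
  exact lintegral_mono_set (Ioc_subset_Ioc hs ht)

end LipPath

/-- If a `1`-Lipschitz function maps `S` onto a set containing `A`, then integrating over `A` costs
at most as much as integrating the composition over `S`. -/
lemma setLIntegral_le_of_subset_image {f : ℝ → ℝ} {S A : Set ℝ} (hf : LipschitzOnWith 1 f S)
    (hS : MeasurableSet S) (hA : A ⊆ f '' S) (h : ℝ → ℝ≥0∞) :
    ∫⁻ u in A, h u ≤ ∫⁻ t in S, h (f t) := by
  have hfm : AEMeasurable f (volume.restrict S) := hf.continuousOn.aemeasurable hS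
  have key : volume.restrict A ≤ Measure.map f (volume.restrict S) := by
    refine Measure.le_iff.2 fun B hB => ?_
    rw [Measure.restrict_apply hB, Measure.map_apply_of_aemeasurable hfm hB]
    refine le_trans ?_ (Measure.le_restrict_apply _ _)
    have hsub : B ∩ A ⊆ f '' (f ⁻¹' B ∩ S) := by
      rintro y ⟨hyB, hyA⟩
      obtain ⟨x, hx, rfl⟩ := hA hyA
      exact ⟨x, ⟨hyB, hx⟩, rfl⟩
    refine (measure_mono hsub).trans ?_
    have := (hf.mono (inter_subset_right : f ⁻¹' B ∩ S ⊆ S)).hausdorffMeasure_image_le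
      (d := 1) zero_le_one
    simpa [hausdorffMeasure_real] using this
  obtain ⟨g, hg, hgh, hint⟩ := exists_measurable_le_lintegral_eq (μ := volume.restrict A) h
  rw [hint]
  calc ∫⁻ u in A, g u ≤ ∫⁻ u, g u ∂(Measure.map f (volume.restrict S)) := lintegral_mono' key le_rfl
    _ = ∫⁻ t in S, g (f t) := lintegral_map' hg.aemeasurable hfm
    _ ≤ _ := lintegral_mono fun t => hgh _

/-! ### Curves and their arclength parametrizations -/

section variation
variable {E : Type*} [PseudoMetricSpace E] {f : ℝ → E} {a b : ℝ}

lemma continuousOn_variationOnFromTo (hf : ContinuousOn f (Icc a b))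
    (hb : BoundedVariationOn f (Icc a b)) (hab : a ≤ b) :
    ContinuousOn (variationOnFromTo f (Icc a b) a) (Icc a b) := by
  intro x hx
  have hl := hb.locallyBoundedVariationOn
  have ha : a ∈ Icc a b := ⟨le_rfl, hab⟩
  have h1 := hb.tendsto_eVariationOn_Icc_zero_left (x := x) ((hf x hx).mono inter_subset_left)
  have h2 := hb.tendsto_eVariationOn_Icc_zero_right x ((hf x hx).mono inter_subset_left)
  have h3 := (ENNReal.tendsto_toReal ENNReal.zero_ne_top).comp (by simpa using h1.add h2)
  refine tendsto_iff_dist_tendsto_zero.2 (squeeze_zero' (Filter.Eventually.of_forall fun _ =>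
    dist_nonneg) ?_ h3)
  filter_upwards [self_mem_nhdsWithin] with y hy
  have hfin : ∀ u w, eVariationOn f (Icc a b ∩ Icc u w) ≠ ∞ := fun u w =>
    hb.mono inter_subset_left
  simp only [Function.comp_apply]
  rw [Real.dist_eq, variationOnFromTo.sub_right hl ha hy hx, ENNReal.toReal_add (hfin _ _)
    (hfin _ _)]
  rcases le_total x y with h | h
  · rw [variationOnFromTo.eq_of_le _ _ h, abs_of_nonneg ENNReal.toReal_nonneg]
    exact le_add_of_nonneg_left ENNReal.toReal_nonneg
  · rw [variationOnFromTo.eq_of_ge _ _ h, abs_neg, abs_of_nonneg ENNReal.toReal_nonneg]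
    exact le_add_of_nonneg_right ENNReal.toReal_nonneg

lemma variationOnFromTo_right (hab : a ≤ b) :
    variationOnFromTo f (Icc a b) a b = (eVariationOn f (Icc a b)).toReal := by
  rw [variationOnFromTo.eq_of_le _ _ hab, inter_self]

lemma image_variationOnFromTo (hf : ContinuousOn f (Icc a b))
    (hb : BoundedVariationOn f (Icc a b)) (hab : a ≤ b) :
    variationOnFromTo f (Icc a b) a '' Icc a b = Icc 0 (eVariationOn f (Icc a b)).toReal := by
  have ha : a ∈ Icc a b := ⟨le_rfl, hab⟩
  have hb' : b ∈ Icc a b := ⟨hab, le_rfl⟩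
  have hm := variationOnFromTo.monotoneOn hb.locallyBoundedVariationOn ha
  apply Subset.antisymm
  · rintro _ ⟨t, ht, rfl⟩
    refine ⟨variationOnFromTo.nonneg_of_le _ _ ht.1, ?_⟩
    rw [← variationOnFromTo_right hab]
    exact hm ht hb' ht.2
  · have := intermediate_value_Icc hab (continuousOn_variationOnFromTo hf hb hab)
    rwa [variationOnFromTo.self, variationOnFromTo_right hab] at this

end variation

variable {n : ℕ}

namespace Curve

variable (γ : Curve n)

lemma arclengthParam_variation (h : γ.Rectifiable) {t : ℝ} (ht : t ∈ Icc γ.a γ.b) :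
    γ.arclengthParam (variationOnFromTo γ.toFun (Icc γ.a γ.b) γ.a t) = γ.toFun t :=
  edist_eq_zero.1 <| edist_naturalParameterization_eq_zero
    (BoundedVariationOn.locallyBoundedVariationOn h) ⟨le_rfl, γ.le⟩ ht

lemma lipschitzOnWith_arclengthParam (h : γ.Rectifiable) :
    LipschitzOnWith 1 γ.arclengthParam (Icc 0 γ.length.toReal) := by
  have hu := has_unit_speed_naturalParameterization γ.toFun
    (BoundedVariationOn.locallyBoundedVariationOn h) (a := γ.a) ⟨le_rfl, γ.le⟩
  rw [image_variationOnFromTo γ.continuousOn h γ.le] at hu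
  intro x hx y hy
  wlog hxy : x ≤ y generalizing x y
  · rw [edist_comm, edist_comm x]; exact this hy hx (le_of_not_ge hxy)
  have := hu hx hy
  rw [ENNReal.coe_one, one_mul, edist_comm x, edist_dist y, Real.dist_eq,
    abs_of_nonneg (sub_nonneg.2 hxy)]
  simp only [NNReal.coe_one, one_mul] at this
  rw [← this]
  exact eVariationOn.edist_le _ ⟨hx, le_rfl, hxy⟩ ⟨hy, hxy, le_rfl⟩

/-- A rectifiable curve, parametrized by arclength. -/
lemma exists_lipPath (h : γ.Rectifiable) :
    ∃ c : LipPath n, c.source = γ.toFun γ.a ∧ c.target = γ.toFun γ.b ∧ c.trace ⊆ γ.trace ∧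
      ∀ ρ, c.cost ρ = γ.lineIntegral ρ := by
  set l := γ.length.toReal with hl
  have hl0 : 0 ≤ l := ENNReal.toReal_nonneg
  have hlip : LipschitzWith 1 (fun u => γ.arclengthParam (projIcc 0 l hl0 u)) := by
    have := ((γ.lipschitzOnWith_arclengthParam h).to_restrict).comp
      (LipschitzWith.projIcc hl0)
    rwa [one_mul] at this
  have heq : ∀ u ∈ Icc 0 l, γ.arclengthParam (projIcc 0 l hl0 u) = γ.arclengthParam u :=
    fun u hu => by rw [projIcc_of_mem hl0 hu]
  refine ⟨⟨l, hl0, _, hlip⟩, ?_, ?_, ?_, fun ρ => ?_⟩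
  · simp only [LipPath.source]
    rw [heq 0 ⟨le_rfl, hl0⟩, ← γ.arclengthParam_variation h ⟨le_rfl, γ.le⟩, variationOnFromTo.self]
  · simp only [LipPath.target]
    rw [heq l ⟨hl0, le_rfl⟩, ← γ.arclengthParam_variation h ⟨γ.le, le_rfl⟩,
      variationOnFromTo_right γ.le]
    rfl
  · rintro _ ⟨u, hu, rfl⟩
    have hu' := hu
    rw [show Icc 0 l = _ from (image_variationOnFromTo γ.continuousOn h γ.le).symm] at hu'
    obtain ⟨t, ht, rfl⟩ := hu'
    exact ⟨t, ht, by simp only [heq _ hu, γ.arclengthParam_variation h ht]⟩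
  · simp only [LipPath.cost, lineIntegral]
    rw [← hl, ← setLIntegral_congr Ioc_ae_eq_Icc]
    exact setLIntegral_congr_fun measurableSet_Ioc fun u hu => by
      simp only [heq u (Ioc_subset_Icc_self hu)]

end Curve

namespace LipPath

variable (c : LipPath n)

/-- A path, as a curve. -/
def toCurve : Curve n := ⟨0, c.len, c.len_nonneg, c.toFun, c.lip.continuous.continuousOn⟩

lemma eVariationOn_le (s t : ℝ) :
    eVariationOn c.toFun (Icc s t) ≤ ENNReal.ofReal (t - s) := by
  have := (c.lip.lipschitzOnWith (s := univ)).comp_eVariationOn_le (g := id) (s := Icc s t)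
    (fun _ _ => mem_univ _)
  simpa [eVariationOn_id_Icc] using this

lemma rectifiable_toCurve : c.toCurve.Rectifiable :=
  ((c.eVariationOn_le _ _).trans_lt ENNReal.ofReal_lt_top).ne

lemma lineIntegral_toCurve_le (ρ : EuclideanSpace ℝ (Fin n) → ℝ≥0∞) :
    c.toCurve.lineIntegral ρ ≤ c.cost ρ := by
  have hb : BoundedVariationOn c.toFun (Icc 0 c.len) := c.rectifiable_toCurve
  have h0 : (0 : ℝ) ∈ Icc 0 c.len := ⟨le_rfl, c.len_nonneg⟩
  set v := variationOnFromTo c.toFun (Icc 0 c.len) 0 with hv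
  -- The arclength is a `1`-Lipschitz function of the parameter.
  have hlip : LipschitzOnWith 1 v (Icc 0 c.len) := by
    refine LipschitzOnWith.of_dist_le_mul fun s hs t ht => ?_
    wlog hst : s ≤ t generalizing s t
    · rw [dist_comm, dist_comm s]; exact this t ht s hs (le_of_not_ge hst)
    rw [dist_comm, Real.dist_eq, variationOnFromTo.sub_right hb.locallyBoundedVariationOn h0 ht hs,
      variationOnFromTo.eq_of_le _ _ hst, abs_of_nonneg ENNReal.toReal_nonneg, NNReal.coe_one,
      one_mul, dist_comm, Real.dist_eq, abs_of_nonneg (sub_nonneg.2 hst)]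
    exact ENNReal.toReal_le_of_le_ofReal (sub_nonneg.2 hst)
      ((eVariationOn.mono _ inter_subset_right).trans (c.eVariationOn_le _ _))
  have himg := image_variationOnFromTo c.lip.continuous.continuousOn hb c.len_nonneg
  refine (setLIntegral_le_of_subset_image hlip measurableSet_Icc himg.ge _).trans_eq ?_
  rw [cost, setLIntegral_congr Ioc_ae_eq_Icc]
  exact setLIntegral_congr_fun measurableSet_Icc fun t ht => by
    rw [hv, show variationOnFromTo c.toFun (Icc 0 c.len) 0 t
      = variationOnFromTo c.toCurve.toFun (Icc c.toCurve.a c.toCurve.b) c.toCurve.a t from rfl,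
      c.toCurve.arclengthParam_variation c.rectifiable_toCurve ht]
    rfl

end LipPath

/-! ### Modulus in terms of one-Lipschitz paths -/

/-- A function is admissible for the paths from `F₁` to `F₂` whose interior has the property `P`
if each of them has cost at least one. -/
def LipAdmissible (P : Set (EuclideanSpace ℝ (Fin n)) → Prop)
    (F₁ F₂ : Set (EuclideanSpace ℝ (Fin n))) (ρ : EuclideanSpace ℝ (Fin n) → ℝ≥0∞) : Prop :=
  Measurable ρ ∧ ∀ c : LipPath n, c.source ∈ F₁ → c.target ∈ F₂ → P c.inner → 1 ≤ c.cost ρ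

/-- The `n`-modulus of the family of paths from `F₁` to `F₂` whose interior has property `P`. -/
noncomputable def lipModulus (P : Set (EuclideanSpace ℝ (Fin n)) → Prop)
    (F₁ F₂ : Set (EuclideanSpace ℝ (Fin n))) : ℝ≥0∞ :=
  ⨅ (ρ : EuclideanSpace ℝ (Fin n) → ℝ≥0∞) (_ : LipAdmissible P F₁ F₂ ρ), ∫⁻ x, ρ x ^ n

section lipModulus
variable {P : Set (EuclideanSpace ℝ (Fin n)) → Prop} {F₁ F₂ : Set (EuclideanSpace ℝ (Fin n))}

lemma LipAdmissible.lipModulus_le {ρ : EuclideanSpace ℝ (Fin n) → ℝ≥0∞}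
    (h : LipAdmissible P F₁ F₂ ρ) : lipModulus P F₁ F₂ ≤ ∫⁻ x, ρ x ^ n := iInf₂_le ρ h

/-- The modulus of a family of curves described by a monotone property of the interior can be
computed with `1`-Lipschitz paths. Endpoints may be visited several times by a curve; shortening it
at both ends reduces to curves that visit them only once. -/
lemma modulus_eq_lipModulus (hdisj : Disjoint F₁ F₂) (hP : ∀ A B, A ⊆ B → P B → P A)
    {Γ : Set (Curve n)} (h1 : ∀ γ ∈ Γ, P (γ.trace \ γ.endpoints))
    (h2 : ∀ γ : Curve n, P (γ.toFun '' Ioo γ.a γ.b) → γ ∈ Γ) :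
    modulus (joining F₁ F₂ univ ∩ Γ) = lipModulus P F₁ F₂ := by
  have key : ∀ ρ, Admissible (joining F₁ F₂ univ ∩ Γ) ρ ↔ LipAdmissible P F₁ F₂ ρ := by
    intro ρ
    refine and_congr_right fun _ => ⟨fun h c hc1 hc2 hc => ?_, fun h γ hγ hr => ?_⟩
    · refine (h c.toCurve ⟨⟨?_, hc1, hc2, subset_univ _⟩, h2 _ hc⟩ c.rectifiable_toCurve).trans
        (c.lineIntegral_toCurve_le ρ)
      simp
    · obtain ⟨c, hs, ht, htr, hcost⟩ := γ.exists_lipPath hr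
      have hne : c.source ≠ c.target := by
        rw [hs, ht]
        exact fun e => hdisj.ne_of_mem hγ.1.2.1 hγ.1.2.2.1 e
      obtain ⟨s, t, hs0, hst, htL, hcs, hct, hav⟩ := c.exists_restrict_avoiding_endpoints hne
      rw [← hcost]
      refine (h (c.restrict s t hst.le) ?_ ?_ ?_).trans (c.cost_restrict_le _ hs0 htL ρ)
      · rw [LipPath.source_restrict, hcs, hs]; exact hγ.1.2.1
      · rw [LipPath.target_restrict, hct, ht]; exact hγ.1.2.2.1
      · refine hP _ _ ?_ (h1 γ hγ.2)
        rw [LipPath.inner_restrict]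
        rintro _ ⟨u, hu, rfl⟩
        refine ⟨htr ⟨u, ⟨hs0.trans hu.1.le, hu.2.le.trans htL⟩, rfl⟩, ?_⟩
        have := hav u hu
        rw [hs, ht] at this
        simpa [Curve.endpoints, not_or] using this
  simp only [modulus, lipModulus, key]

lemma modulus_joining (hdisj : Disjoint F₁ F₂) :
    modulus (joining F₁ F₂ univ) = lipModulus (fun _ => True) F₁ F₂ := by
  simpa using modulus_eq_lipModulus (P := fun _ => True) hdisj (fun _ _ _ _ => trivial)
    (Γ := univ) (fun _ _ => trivial) (fun _ _ => mem_univ _)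

lemma modulus_joining_avoiding (hdisj : Disjoint F₁ F₂) (E : Set (EuclideanSpace ℝ (Fin n))) :
    modulus (joining F₁ F₂ univ ∩ avoiding E) = lipModulus (fun A => Disjoint A E) F₁ F₂ := by
  refine modulus_eq_lipModulus hdisj (fun A B h hB => hB.mono_left h) (fun γ h => h)
    fun γ h => h.mono_left ?_
  rintro _ ⟨⟨t, ht, rfl⟩, hne⟩
  simp only [Curve.endpoints, mem_insert_iff, mem_singleton_iff, not_or] at hne
  exact ⟨t, ⟨lt_of_le_of_ne ht.1 fun e => hne.1 (e ▸ rfl),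
    lt_of_le_of_ne ht.2 fun e => hne.2 (e ▸ rfl)⟩, rfl⟩

lemma modulus_joining_meetingCountably (hdisj : Disjoint F₁ F₂)
    (E : Set (EuclideanSpace ℝ (Fin n))) :
    modulus (joining F₁ F₂ univ ∩ meetingCountably E) =
      lipModulus (fun A => (A ∩ E).Countable) F₁ F₂ := by
  refine modulus_eq_lipModulus hdisj (fun A B h hB => hB.mono (inter_subset_inter_left _ h))
    (fun γ h => Countable.mono (s₂ := E ∩ γ.trace) (fun x hx => ⟨hx.2, hx.1.1⟩) h)
    fun γ h => Countable.mono ?_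
      (h.union ((countable_singleton (γ.toFun γ.b)).insert (γ.toFun γ.a)))
  rintro _ ⟨hxE, t, ht, rfl⟩
  rcases ht.1.eq_or_lt with h0 | h0
  · exact Or.inr (Or.inl (h0 ▸ rfl))
  rcases ht.2.eq_or_lt with h1 | h1
  · exact Or.inr (Or.inr (h1 ▸ rfl))
  · exact Or.inl ⟨⟨t, ⟨h0, h1⟩, rfl⟩, hxE⟩

end lipModulus

/-! ### The Loewner property of Euclidean space -/


/-- In a connected set that is not small, most points `p` are such that the mass of a small measure
in balls around `p` decays linearly: by the Vitali covering lemma the set of exceptional points is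
covered by balls of small total radius, and so cannot contain a large part of a connected set. -/
lemma exists_measure_closedBall_le {ν : Measure (EuclideanSpace ℝ (Fin n))}
    {F : Set (EuclideanSpace ℝ (Fin n))} (hF : IsPreconnected F)
    {a u : EuclideanSpace ℝ (Fin n)} (ha : a ∈ F) (hu : u ∈ F) {δ R A : ℝ} (hδ : δ ≤ dist u a)
    (hR : 0 < R) (hA : 0 < A) (hν : ν univ * ENNReal.ofReal (10 * R) < ENNReal.ofReal (A * δ)) :
    ∃ p ∈ F, dist p a ≤ δ ∧ ∀ s ∈ Ioc (0 : ℝ) 1,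
      ν (Metric.closedBall p (s * R)) ≤ ENNReal.ofReal (A * s) := by
  by_contra! hcon
  choose! s hs hsν using hcon
  set T : Set (EuclideanSpace ℝ (Fin n)) := {p | p ∈ F ∧ dist p a ≤ δ} with hT
  obtain ⟨v, hvT, hdisj, hcov⟩ := Vitali.exists_disjoint_subfamily_covering_enlargement_closedBall
    T id (fun p => s p * R) R
    (fun p hp => by nlinarith [(hs p hp.1 hp.2).2]) 5 (by norm_num)
  have hpos : ∀ p ∈ v, 0 < s p * R := fun p hp =>
    mul_pos (hs p (hvT hp).1 (hvT hp).2).1 hR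
  have hcount : v.Countable := hdisj.countable_of_nonempty_interior fun p hp =>
    ⟨p, interior_mono Metric.ball_subset_closedBall
      (by simpa [Metric.isOpen_ball.interior_eq] using hpos p hp)⟩
  -- The distances to `a` of the points of `F` fill the interval `[0, δ]`.
  have hsub : Icc 0 δ ⊆ ⋃ p ∈ v, Icc (dist p a - 5 * (s p * R)) (dist p a + 5 * (s p * R)) := by
    intro x hx
    have hcon' : IsPreconnected ((fun y => dist y a) '' F) :=
      hF.image _ (continuous_id.dist continuous_const).continuousOn
    obtain ⟨y, hy, rfl⟩ : x ∈ (fun y => dist y a) '' F :=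
      hcon'.ordConnected.out ⟨a, ha, rfl⟩ ⟨u, hu, rfl⟩ ⟨by simpa using hx.1, hx.2.trans hδ⟩
    obtain ⟨b, hb, hsubset⟩ := hcov y ⟨hy, hx.2⟩
    have hyb : dist y b ≤ 5 * (s b * R) := by
      have := hsubset (Metric.mem_closedBall_self
        (mul_pos (hs y hy hx.2).1 hR).le)
      simpa using this
    have h1 := dist_triangle y b a
    have h2 := dist_triangle b y a
    rw [dist_comm b y] at h2
    exact mem_iUnion₂.2 ⟨b, hb, by constructor <;> simp only <;> linarith⟩
  have hvol : ENNReal.ofReal δ ≤ ∑' p : v, ENNReal.ofReal (10 * (s p * R)) := by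
    calc ENNReal.ofReal δ = volume (Icc 0 δ) := by simp
      _ ≤ ∑' p : v, volume (Icc (dist (p : EuclideanSpace ℝ (Fin n)) a - 5 * (s p * R))
            (dist (p : EuclideanSpace ℝ (Fin n)) a + 5 * (s p * R))) :=
          (measure_mono hsub).trans (measure_biUnion_le _ hcount _)
      _ = _ := by
          congr 1; ext p; rw [Real.volume_Icc]; congr 1; ring
  have hsum : ∑' p : v, ν (Metric.closedBall (p : EuclideanSpace ℝ (Fin n)) (s p * R)) ≤
      ν univ := by
    have := measure_biUnion (μ := ν) hcount hdisj fun _ _ =>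
      Metric.isClosed_closedBall.measurableSet
    exact this.symm.trans_le (measure_mono (subset_univ _))
  refine absurd hν (not_lt.2 ?_)
  calc ENNReal.ofReal (A * δ) = ENNReal.ofReal A * ENNReal.ofReal δ := ENNReal.ofReal_mul hA.le
    _ ≤ ENNReal.ofReal A * ∑' p : v, ENNReal.ofReal (10 * (s p * R)) := by gcongr
    _ = ∑' p : v, ENNReal.ofReal (A * s p) * ENNReal.ofReal (10 * R) := by
        rw [← ENNReal.tsum_mul_left]
        congr 1; ext p
        rw [← ENNReal.ofReal_mul hA.le, ← ENNReal.ofReal_mul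
          (mul_pos hA (hs p (hvT p.2).1 (hvT p.2).2).1).le]
        congr 1; ring
    _ ≤ (∑' p : v, ν (Metric.closedBall (p : EuclideanSpace ℝ (Fin n)) (s p * R))) *
          ENNReal.ofReal (10 * R) := by
        rw [ENNReal.tsum_mul_right]
        gcongr with p
        exact (hsν p (hvT p.2).1 (hvT p.2).2).le
    _ ≤ _ := by gcongr

/-- The line segment from `p` to `z`, parametrized by arclength. -/
noncomputable def segmentPath (p z : EuclideanSpace ℝ (Fin n)) : LipPath n where
  len := dist z p
  len_nonneg := dist_nonneg
  toFun t := p + (t * (dist z p)⁻¹) • (z - p)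
  lip := by
    refine LipschitzWith.of_dist_le_mul fun s t => ?_
    rw [dist_add_left, dist_eq_norm, ← sub_smul, norm_smul, ← sub_mul, norm_mul, Real.dist_eq,
      NNReal.coe_one, one_mul, mul_assoc, ← dist_eq_norm z p, Real.norm_eq_abs, norm_inv,
      Real.norm_of_nonneg dist_nonneg]
    exact mul_le_of_le_one_right (abs_nonneg _) (inv_mul_le_one)

lemma source_segmentPath (p z : EuclideanSpace ℝ (Fin n)) : (segmentPath p z).source = p := by
  simp [LipPath.source, segmentPath]

lemma target_segmentPath (p z : EuclideanSpace ℝ (Fin n)) : (segmentPath p z).target = z := by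
  rcases eq_or_ne z p with rfl | h
  · simp [LipPath.target, segmentPath]
  · simp [LipPath.target, segmentPath, dist_ne_zero.2 h]

lemma cost_segmentPath (p z : EuclideanSpace ℝ (Fin n)) (ρ : EuclideanSpace ℝ (Fin n) → ℝ≥0∞) :
    (segmentPath p z).cost ρ =
      ENNReal.ofReal (dist z p) * ∫⁻ s in Ioc (0 : ℝ) 1, ρ (p + s • (z - p)) := by
  rcases eq_or_ne z p with rfl | h
  · simp [LipPath.cost, segmentPath]
  have hD : 0 < dist z p := dist_pos.2 h
  have hemb : MeasurableEmbedding (fun t : ℝ => t * (dist z p)⁻¹) :=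
    measurableEmbedding_mulRight₀ (inv_ne_zero hD.ne')
  have hmap := Real.map_volume_mul_right (inv_ne_zero hD.ne')
  have hpre : (fun t : ℝ => t * (dist z p)⁻¹) ⁻¹' Ioc 0 1 = Ioc 0 (dist z p) := by
    ext t
    simp only [mem_preimage, mem_Ioc]
    rw [← div_eq_mul_inv, div_pos_iff_of_pos_right hD, div_le_one hD]
  rw [inv_inv, abs_of_pos hD] at hmap
  calc (segmentPath p z).cost ρ
      = ∫⁻ t in (fun t : ℝ => t * (dist z p)⁻¹) ⁻¹' Ioc 0 1,
          ρ (p + (t * (dist z p)⁻¹) • (z - p)) := by rw [hpre]; rfl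
    _ = ∫⁻ s in Ioc (0 : ℝ) 1, ρ (p + s • (z - p))
          ∂(Measure.map (fun t : ℝ => t * (dist z p)⁻¹) volume) := by
        rw [hemb.restrict_map, hemb.lintegral_map]
    _ = _ := by rw [hmap, Measure.restrict_smul, lintegral_smul_measure, smul_eq_mul]

/-- Change of variables under the homothety with center `p` and ratio `s`. -/
lemma lintegral_ball_homothety {ρ : EuclideanSpace ℝ (Fin n) → ℝ≥0∞} (hρ : Measurable ρ)
    (p : EuclideanSpace ℝ (Fin n)) (R : ℝ) {s : ℝ} (hs : 0 < s) :
    ∫⁻ z in Metric.ball p R, ρ (p + s • (z - p)) =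
      ENNReal.ofReal ((s ^ n)⁻¹) * ∫⁻ y in Metric.ball p (s * R), ρ y := by
  set F := (Metric.ball p (s * R)).indicator ρ with hF
  have hFm : Measurable F := hρ.indicator Metric.isOpen_ball.measurableSet
  have h1 : ∫⁻ z in Metric.ball p R, ρ (p + s • (z - p)) = ∫⁻ z, F (p + s • (z - p)) := by
    rw [← lintegral_indicator Metric.isOpen_ball.measurableSet]
    congr 1; ext z
    have : z ∈ Metric.ball p R ↔ p + s • (z - p) ∈ Metric.ball p (s * R) := by
      rw [Metric.mem_ball, Metric.mem_ball, dist_eq_norm, dist_eq_norm, add_sub_cancel_left,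
        norm_smul, Real.norm_of_nonneg hs.le, mul_lt_mul_iff_right₀ hs]
    by_cases hz : z ∈ Metric.ball p R
    · rw [indicator_of_mem hz, hF, indicator_of_mem (this.1 hz)]
    · rw [indicator_of_notMem hz, hF, indicator_of_notMem (mt this.2 hz)]
  have hm : Measurable fun w : EuclideanSpace ℝ (Fin n) => s • w := measurable_const_smul s
  have hmap := Measure.map_addHaar_smul (volume : Measure (EuclideanSpace ℝ (Fin n))) hs.ne'
  rw [finrank_euclideanSpace_fin, abs_of_pos (by positivity)] at hmap
  have hFp : Measurable fun w => F (p + w) := hFm.comp (measurable_const_add p)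
  rw [h1, lintegral_sub_right_eq_self (fun z => F (p + s • z)) p]
  calc ∫⁻ w, F (p + s • w) = ∫⁻ w, F (p + w) ∂(Measure.map (s • ·) volume) :=
        (lintegral_map hFp hm).symm
    _ = _ := by
        rw [hmap, lintegral_smul_measure, smul_eq_mul, lintegral_add_left_eq_self F p, hF,
          lintegral_indicator Metric.isOpen_ball.measurableSet]

lemma volume_ball_eq (p : EuclideanSpace ℝ (Fin n)) {r : ℝ} (hr : 0 < r) :
    volume (Metric.ball p r) = ENNReal.ofReal (r ^ n) *
      volume (Metric.ball (0 : EuclideanSpace ℝ (Fin n)) 1) := by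
  rw [Measure.addHaar_ball_of_pos _ _ hr, finrank_euclideanSpace_fin]

/-- Hölder's inequality, including the case `n = 1`. -/
lemma setLIntegral_le_rpow {ρ : EuclideanSpace ℝ (Fin n) → ℝ≥0∞} (hρ : Measurable ρ)
    (hn : n ≠ 0) (B : Set (EuclideanSpace ℝ (Fin n))) :
    ∫⁻ y in B, ρ y ≤ (∫⁻ y in B, ρ y ^ n) ^ (1 / (n : ℝ)) * volume B ^ (1 - 1 / (n : ℝ)) := by
  have := eLpNorm'_le_eLpNorm'_mul_rpow_measure_univ (μ := volume.restrict B) (p := 1) (q := n)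
    one_pos (by exact_mod_cast Nat.one_le_iff_ne_zero.2 hn) hρ.aestronglyMeasurable
  simpa [eLpNorm'] using this

/-- The constant `∫₀¹ s^(1/n - 1) ds`. -/
noncomputable def rayConst (n : ℕ) : ℝ≥0∞ :=
  ∫⁻ s in Ioc (0 : ℝ) 1, ENNReal.ofReal (s ^ (1 / (n : ℝ) - 1))

lemma rayConst_ne_top (hn : n ≠ 0) : rayConst n ≠ ∞ := by
  have hn' : (0 : ℝ) < 1 / n := by positivity
  have h := (intervalIntegral.intervalIntegrable_rpow' (a := 0) (b := 1)
    (r := 1 / (n : ℝ) - 1) (by linarith)).1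
  exact (h.lintegral_lt_top).ne

/-- The average, over the endpoints `z` in a ball around `p`, of the integral of `ρ` over the
segment `[p, z]` is controlled if the mass of `ρ ^ n` in balls around `p` decays linearly. -/
lemma lintegral_cost_segmentPath_le {ρ : EuclideanSpace ℝ (Fin n) → ℝ≥0∞} (hρ : Measurable ρ)
    (hn : n ≠ 0) (p : EuclideanSpace ℝ (Fin n)) {R A : ℝ} (hR : 0 < R) (hA : 0 < A)
    (h : ∀ s ∈ Ioc (0 : ℝ) 1, ∫⁻ y in Metric.ball p (s * R), ρ y ^ n ≤ ENNReal.ofReal (A * s)) :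
    ∫⁻ z in Metric.ball p R, (segmentPath p z).cost ρ ≤
      rayConst n * ENNReal.ofReal (R ^ n) * ENNReal.ofReal (A ^ (1 / (n : ℝ))) *
        volume (Metric.ball (0 : EuclideanSpace ℝ (Fin n)) 1) ^ (1 - 1 / (n : ℝ)) := by
  set ω := volume (Metric.ball (0 : EuclideanSpace ℝ (Fin n)) 1)
  have hn1 : (1 : ℝ) ≤ n := by exact_mod_cast Nat.one_le_iff_ne_zero.2 hn
  have hn0 : (0 : ℝ) < n := by linarith
  have he : 0 ≤ 1 - 1 / (n : ℝ) := by
    rw [sub_nonneg, div_le_one hn0]; exact hn1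
  have hm : Measurable fun x : EuclideanSpace ℝ (Fin n) × ℝ => ρ (p + x.2 • (x.1 - p)) := by
    fun_prop
  -- The contribution of the points at relative distance `s` from `p`.
  have hinner : ∀ s ∈ Ioc (0 : ℝ) 1, ∫⁻ z in Metric.ball p R, ρ (p + s • (z - p)) ≤
      ENNReal.ofReal (s ^ (1 / (n : ℝ) - 1)) *
        (ENNReal.ofReal (R ^ (n - 1 : ℝ)) * ENNReal.ofReal (A ^ (1 / (n : ℝ))) *
          ω ^ (1 - 1 / (n : ℝ))) := by
    intro s hs
    have hsR : 0 < s * R := mul_pos hs.1 hR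
    rw [lintegral_ball_homothety hρ p R hs.1]
    calc _ ≤ ENNReal.ofReal ((s ^ n)⁻¹) * (ENNReal.ofReal (A * s) ^ (1 / (n : ℝ)) *
          (ENNReal.ofReal ((s * R) ^ n) * ω) ^ (1 - 1 / (n : ℝ))) := by
          rw [← volume_ball_eq p hsR]
          refine mul_le_mul_right ((setLIntegral_le_rpow hρ hn _).trans ?_) _
          gcongr
          exact h s hs
      _ = _ := by
          rw [ENNReal.mul_rpow_of_nonneg _ _ he, ENNReal.ofReal_rpow_of_pos (mul_pos hA hs.1),
            ENNReal.ofReal_rpow_of_pos (by positivity)]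
          rw [← mul_assoc, ← mul_assoc, ← mul_assoc, ← mul_assoc,
            ← ENNReal.ofReal_mul (by have := hs.1; positivity),
            ← ENNReal.ofReal_mul (by have := hs.1; positivity),
            ← ENNReal.ofReal_mul (by have := hs.1; positivity),
            ← ENNReal.ofReal_mul (by have := hs.1; positivity)]
          congr 2
          have hs0 := hs.1
          rw [Real.mul_rpow hA.le hs0.le, ← Real.rpow_natCast, ← Real.rpow_natCast,
            ← Real.rpow_mul hsR.le, Real.mul_rpow hs0.le hR.le, ← Real.rpow_neg hs0.le]
          rw [show (n : ℝ) * (1 - 1 / n) = n - 1 by field_simp,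
            show 1 / (n : ℝ) - 1 = -n + 1 / n + (n - 1) by ring,
            Real.rpow_add hs0, Real.rpow_add hs0]
          ring
  calc ∫⁻ z in Metric.ball p R, (segmentPath p z).cost ρ
      ≤ ∫⁻ z in Metric.ball p R, ENNReal.ofReal R * ∫⁻ s in Ioc (0 : ℝ) 1, ρ (p + s • (z - p)) := by
        refine setLIntegral_mono' Metric.isOpen_ball.measurableSet fun z hz => ?_
        rw [cost_segmentPath]
        gcongr
        exact (Metric.mem_ball.1 hz).le
    _ = ENNReal.ofReal R * ∫⁻ s in Ioc (0 : ℝ) 1, ∫⁻ z in Metric.ball p R, ρ (p + s • (z - p)) := by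
        rw [lintegral_const_mul' _ _ ENNReal.ofReal_ne_top,
          lintegral_lintegral_swap hm.aemeasurable]
    _ ≤ ENNReal.ofReal R * ∫⁻ s in Ioc (0 : ℝ) 1, ENNReal.ofReal (s ^ (1 / (n : ℝ) - 1)) *
        (ENNReal.ofReal (R ^ (n - 1 : ℝ)) * ENNReal.ofReal (A ^ (1 / (n : ℝ))) *
          ω ^ (1 - 1 / (n : ℝ))) := by
        gcongr ENNReal.ofReal R * ?_
        exact setLIntegral_mono' measurableSet_Ioc hinner
    _ = (ENNReal.ofReal R * ENNReal.ofReal (R ^ (n - 1 : ℝ))) * rayConst n *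
          ENNReal.ofReal (A ^ (1 / (n : ℝ))) * ω ^ (1 - 1 / (n : ℝ)) := by
        rw [lintegral_mul_const _ (by fun_prop), ← rayConst]
        ring
    _ = _ := by
        rw [← ENNReal.ofReal_mul hR.le, ← Real.rpow_one_add' hR.le (by linarith)]
        rw [show (1 : ℝ) + (n - 1) = n by ring, Real.rpow_natCast]
        ring

/-- Continua of small relative distance have points at a distance that is controlled by the
diameters. -/
lemma exists_dist_le_of_relativeDistance_le {F₁ F₂ : Set (EuclideanSpace ℝ (Fin n))}
    (h₁ : IsContinuum F₁) (h₂ : IsContinuum F₂) (hn₁ : F₁.Nontrivial) (hn₂ : F₂.Nontrivial)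
    {t : ℝ} (h : relativeDistance F₁ F₂ ≤ t) :
    ∃ a ∈ F₁, ∃ b ∈ F₂, ∃ u ∈ F₁, ∃ v ∈ F₂, ∃ δ > 0,
      δ ≤ dist u a ∧ δ ≤ dist v b ∧ dist a b ≤ 4 * t * δ := by
  have hd : ∀ {F : Set (EuclideanSpace ℝ (Fin n))}, IsContinuum F → F.Nontrivial →
      0 < Metric.diam F := fun hF hn => by
    obtain ⟨x, hx, y, hy, hxy⟩ := hn
    exact (dist_pos.2 hxy).trans_le (Metric.dist_le_diam_of_mem hF.1.isBounded hx hy)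
  set d := min (Metric.diam F₁) (Metric.diam F₂) with hdef
  have hd0 : 0 < d := lt_min (hd h₁ hn₁) (hd h₂ hn₂)
  have hfar : ∀ {F : Set (EuclideanSpace ℝ (Fin n))} (a), d ≤ Metric.diam F →
      ∃ u ∈ F, d / 4 ≤ dist u a := fun {F} a hF => by
    by_contra! hcon
    have : Metric.diam F ≤ d / 2 := Metric.diam_le_of_forall_dist_le (by positivity)
      fun x hx y hy => by
        linarith [dist_triangle_right x y a, hcon x hx, hcon y hy]
    linarith
  obtain ⟨⟨a, b⟩, ⟨ha, hb⟩, hmin⟩ := (h₁.1.prod h₂.1).exists_isMinOn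
    (h₁.2.nonempty.prod h₂.2.nonempty)
    (f := fun x : EuclideanSpace ℝ (Fin n) × EuclideanSpace ℝ (Fin n) => dist x.1 x.2)
    continuous_dist.continuousOn
  obtain ⟨u, hu, hud⟩ := hfar a (min_le_left _ _ : d ≤ Metric.diam F₁)
  obtain ⟨v, hv, hvd⟩ := hfar b (min_le_right _ _ : d ≤ Metric.diam F₂)
  refine ⟨a, ha, b, hb, u, hu, v, hv, d / 4, by positivity, hud, hvd, ?_⟩
  have h1 : dist a b ≤ sInf (image2 dist F₁ F₂) := by
    refine le_csInf ⟨_, mem_image2_of_mem ha hb⟩ ?_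
    rintro _ ⟨x, hx, y, hy, rfl⟩
    exact isMinOn_iff.1 hmin (x, y) ⟨hx, hy⟩
  rw [relativeDistance, ← hdef, div_le_iff₀ hd0] at h
  linarith

/-- Euclidean space is a Loewner space: the modulus of the family of all paths joining two
non-degenerate continua is bounded below in terms of their relative distance. -/
theorem loewner (hn : n ≠ 0) {t : ℝ} (ht : 0 < t) :
    ∃ φ : ℝ, 0 < φ ∧ ∀ F₁ F₂ : Set (EuclideanSpace ℝ (Fin n)), IsContinuum F₁ → IsContinuum F₂ →
      F₁.Nontrivial → F₂.Nontrivial → relativeDistance F₁ F₂ ≤ t →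
      ENNReal.ofReal φ ≤ lipModulus (fun _ => True) F₁ F₂ := by
  set ω := volume (Metric.ball (0 : EuclideanSpace ℝ (Fin n)) 1) with hω
  have hω0 : ω ≠ 0 := (Metric.measure_ball_pos _ _ one_pos).ne'
  have hωt : ω ≠ ∞ := measure_ball_lt_top.ne
  have hn1 : (1 : ℝ) ≤ n := by exact_mod_cast Nat.one_le_iff_ne_zero.2 hn
  have hn0 : (0 : ℝ) < n := by linarith
  have he : 0 ≤ 1 - 1 / (n : ℝ) := by
    rw [sub_nonneg, div_le_one hn0]; exact hn1
  -- `T * δ` bounds the distances from `q` to the points of the ball of radius `δ` around `p` below.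
  set T : ℝ := 3 + 4 * t with hT
  have hT0 : 0 < T := by positivity
  set c : ℝ≥0∞ := 2 * (rayConst n * ENNReal.ofReal (T ^ n)) * ω ^ (1 - 1 / (n : ℝ)) with hc
  have hct : c ≠ ∞ := by
    refine ENNReal.mul_ne_top (ENNReal.mul_ne_top (by simp) (ENNReal.mul_ne_top
      (rayConst_ne_top hn) ENNReal.ofReal_ne_top)) (ENNReal.rpow_ne_top_of_nonneg he hωt)
  obtain ⟨A, hA, hAc⟩ : ∃ A : ℝ, 0 < A ∧ c * ENNReal.ofReal (A ^ (1 / (n : ℝ))) < ω := by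
    have h1 : Filter.Tendsto (fun A : ℝ => c * ENNReal.ofReal (A ^ (1 / (n : ℝ))))
        (nhdsWithin 0 (Ioi 0)) (nhds (c * ENNReal.ofReal (0 ^ (1 / (n : ℝ))))) := by
      refine Filter.Tendsto.mono_left ?_ nhdsWithin_le_nhds
      refine ENNReal.Tendsto.const_mul ?_ (Or.inr hct)
      exact ENNReal.tendsto_ofReal
        (Real.continuousAt_rpow_const _ _ (Or.inr (by positivity)))
    rw [Real.zero_rpow (by positivity), ENNReal.ofReal_zero, mul_zero] at h1
    obtain ⟨A, h2, h3⟩ := ((h1.eventually (gt_mem_nhds (pos_iff_ne_zero.2 hω0))).and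
      self_mem_nhdsWithin).exists
    exact ⟨A, h3, h2⟩
  -- With this constant, functions of smaller norm satisfy the smallness condition of
  -- `exists_measure_closedBall_le` at the scale `R = T * δ`.
  refine ⟨A / (10 * T), by positivity, fun F₁ F₂ h₁ h₂ hn₁ hn₂ hrel => ?_⟩
  refine le_iInf₂ fun ρ hρ => ?_
  by_contra! hlt
  obtain ⟨a, ha, b, hb, u, hu, v, hv, δ, hδ, hua, hvb, hab⟩ :=
    exists_dist_le_of_relativeDistance_le h₁ h₂ hn₁ hn₂ hrel
  set R := T * δ with hR
  have hR0 : 0 < R := by positivity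
  set ν := (volume : Measure (EuclideanSpace ℝ (Fin n))).withDensity (fun x => ρ x ^ n) with hν
  have hνball : ∀ {q : EuclideanSpace ℝ (Fin n)} {r : ℝ},
      ∫⁻ y in Metric.ball q r, ρ y ^ n ≤ ν (Metric.closedBall q r) := fun {q r} => by
    rw [hν, withDensity_apply _ Metric.isClosed_closedBall.measurableSet]
    exact lintegral_mono_set Metric.ball_subset_closedBall
  have hνu : ν univ * ENNReal.ofReal (10 * R) < ENNReal.ofReal (A * δ) := by
    rw [hν, withDensity_apply _ MeasurableSet.univ, Measure.restrict_univ]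
    calc _ < ENNReal.ofReal (A / (10 * T)) * ENNReal.ofReal (10 * R) :=
          ENNReal.mul_lt_mul_left (by simp; positivity) ENNReal.ofReal_ne_top hlt
      _ = _ := by
          rw [← ENNReal.ofReal_mul (by positivity)]
          congr 1; rw [hR]; field_simp
  obtain ⟨p, hp, hpa, hpν⟩ := exists_measure_closedBall_le h₁.2.isPreconnected ha hu hua hR0 hA hνu
  obtain ⟨q, hq, hqb, hqν⟩ := exists_measure_closedBall_le h₂.2.isPreconnected hb hv hvb hR0 hA hνu
  have hIp := lintegral_cost_segmentPath_le hρ.1 hn p hR0 hA fun s hs => hνball.trans (hpν s hs)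
  have hIq := lintegral_cost_segmentPath_le hρ.1 hn q hR0 hA fun s hs => hνball.trans (hqν s hs)
  have hsubp : Metric.ball p δ ⊆ Metric.ball p R := Metric.ball_subset_ball (by nlinarith)
  have hsubq : Metric.ball p δ ⊆ Metric.ball q R := by
    refine Metric.ball_subset_ball' ?_
    have := dist_triangle4 p a b q
    rw [dist_comm b q] at this
    rw [hR, hT]
    linarith
  -- Each broken line from `p` to `q` through a point near `p` has cost at least one.
  have hone : ∀ z, 1 ≤ (segmentPath p z).cost ρ + (segmentPath q z).cost ρ := fun z => by
    have hcon : (segmentPath p z).target = (segmentPath q z).reverse.source := by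
      rw [LipPath.source_reverse, target_segmentPath, target_segmentPath]
    have := hρ.2 ((segmentPath p z).concat (segmentPath q z).reverse)
      (by rwa [LipPath.source_concat, source_segmentPath])
      (by rwa [LipPath.target_concat hcon, LipPath.target_reverse, source_segmentPath]) trivial
    rwa [LipPath.cost_concat hcon, LipPath.cost_reverse] at this
  have hmeas : Measurable fun z => (segmentPath p z).cost ρ := by
    simp only [cost_segmentPath]
    refine Measurable.mul (by fun_prop) ?_
    have hm : Measurable fun x : EuclideanSpace ℝ (Fin n) × ℝ => ρ (p + x.2 • (x.1 - p)) := by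
      have := hρ.1
      fun_prop
    exact hm.lintegral_prod_right'
  have hfin : ENNReal.ofReal (δ ^ n) * ω ≤
      ENNReal.ofReal (δ ^ n) * (c * ENNReal.ofReal (A ^ (1 / (n : ℝ)))) := by
    calc ENNReal.ofReal (δ ^ n) * ω = ∫⁻ z in Metric.ball p δ, 1 := by
          rw [setLIntegral_one, volume_ball_eq p hδ]
      _ ≤ ∫⁻ z in Metric.ball p δ, ((segmentPath p z).cost ρ + (segmentPath q z).cost ρ) :=
          lintegral_mono fun z => hone z
      _ = (∫⁻ z in Metric.ball p δ, (segmentPath p z).cost ρ) +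
            ∫⁻ z in Metric.ball p δ, (segmentPath q z).cost ρ := lintegral_add_left hmeas _
      _ ≤ (∫⁻ z in Metric.ball p R, (segmentPath p z).cost ρ) +
            ∫⁻ z in Metric.ball q R, (segmentPath q z).cost ρ :=
          add_le_add (lintegral_mono_set hsubp) (lintegral_mono_set hsubq)
      _ ≤ _ := add_le_add hIp hIq
      _ = _ := by
          rw [hR, mul_pow, ENNReal.ofReal_mul (by positivity), hc]
          ring
  have hδ0 : ENNReal.ofReal (δ ^ n) ≠ 0 := by simp; positivity
  exact absurd ((ENNReal.mul_le_mul_iff_right hδ0 ENNReal.ofReal_ne_top).1 hfin) (not_le.2 hAc)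

/-! ### Paths crossing annuli -/


/-- A path that crosses the annulus `r₁ ≤ |y - x| < r₂` and meets `Z` in a countable set spends time
at least `r₂ - r₁` in the annulus outside `Z`. -/
lemma LipPath.mul_ofReal_sub_le_cost (c : LipPath n) {x : EuclideanSpace ℝ (Fin n)} {r₁ r₂ : ℝ}
    (h₁ : dist c.source x ≤ r₁) (h₂ : ∃ y ∈ c.trace, r₂ ≤ dist y x)
    {Z : Set (EuclideanSpace ℝ (Fin n))} (hZ : (c.trace ∩ Z).Countable)
    {ρ : EuclideanSpace ℝ (Fin n) → ℝ≥0∞} {k : ℝ≥0∞}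
    (hk : ∀ y, r₁ ≤ dist y x → dist y x < r₂ → y ∉ Z → k ≤ ρ y) :
    k * ENNReal.ofReal (r₂ - r₁) ≤ c.cost ρ := by
  obtain ⟨_, ⟨t₀, ht₀, rfl⟩, h₂⟩ := h₂
  set f : ℝ → ℝ := fun t => dist (c.toFun t) x with hf
  have hfl : LipschitzWith 1 f := LipschitzWith.of_dist_le_mul fun s t => by
    rw [NNReal.coe_one, one_mul]
    exact (dist_dist_dist_le_left _ _ _).trans (c.dist_le s t)
  set N : Set ℝ := (fun y => dist y x) '' (c.trace ∩ Z) with hN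
  set A : Set ℝ := Ico r₁ r₂ \ N with hA
  have hAm : MeasurableSet A := measurableSet_Ico.diff (hZ.image _).measurableSet
  have hAf : A ⊆ f '' Icc 0 c.len := by
    intro u hu
    have := intermediate_value_Icc ht₀.1 (f := f) hfl.continuous.continuousOn
    obtain ⟨t, ht, rfl⟩ := this ⟨h₁.trans hu.1.1, (hu.1.2.trans_le h₂).le⟩
    exact ⟨t, ⟨ht.1, ht.2.trans ht₀.2⟩, rfl⟩
  calc k * ENNReal.ofReal (r₂ - r₁) = ∫⁻ u in A, A.indicator (fun _ => k) u := by
        rw [setLIntegral_indicator hAm, inter_self, setLIntegral_const, hA,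
          measure_sdiff_null ((hZ.image _).measure_zero _), Real.volume_Ico]
    _ ≤ ∫⁻ t in Icc 0 c.len, A.indicator (fun _ => k) (f t) :=
        setLIntegral_le_of_subset_image hfl.lipschitzOnWith measurableSet_Icc hAf _
    _ ≤ ∫⁻ t in Icc 0 c.len, ρ (c.toFun t) := by
        refine setLIntegral_mono' measurableSet_Icc fun t ht => ?_
        by_cases hft : f t ∈ A
        · rw [indicator_of_mem hft]
          exact hk _ hft.1.1 hft.1.2 fun hz => hft.2 ⟨_, ⟨⟨t, ht, rfl⟩, hz⟩, rfl⟩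
        · simp [indicator_of_notMem hft]
    _ = c.cost ρ := (setLIntegral_congr Ioc_ae_eq_Icc).symm

lemma LipPath.mul_ofReal_sub_le_cost' (c : LipPath n) {x : EuclideanSpace ℝ (Fin n)} {r₁ r₂ : ℝ}
    (h₁ : dist c.source x ≤ r₁) (h₂ : ∃ y ∈ c.trace, r₂ ≤ dist y x)
    {ρ : EuclideanSpace ℝ (Fin n) → ℝ≥0∞} {k : ℝ≥0∞}
    (hk : ∀ y, r₁ ≤ dist y x → dist y x < r₂ → k ≤ ρ y) :
    k * ENNReal.ofReal (r₂ - r₁) ≤ c.cost ρ :=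
  c.mul_ofReal_sub_le_cost h₁ h₂ (Z := ∅) (by simp) fun y h h' _ => hk y h h'

/-- In dimension at least two the paths that escape from a ball to a much larger concentric ball
have small modulus. The test function weights each of many dyadic annuli equally. -/
lemma exists_weight_of_escape (hn : 2 ≤ n) {ε : ℝ≥0∞} (hε : ε ≠ 0) :
    ∃ M : ℝ, 1 ≤ M ∧ ∀ (x : EuclideanSpace ℝ (Fin n)) (r : ℝ), 0 < r →
      ∃ σ : EuclideanSpace ℝ (Fin n) → ℝ≥0∞, Measurable σ ∧ ∫⁻ y, σ y ^ n ≤ ε ∧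
        ∀ c : LipPath n, dist c.source x ≤ r → (∃ y ∈ c.trace, M * r ≤ dist y x) →
          1 ≤ c.cost σ := by
  set ω := volume (Metric.ball (0 : EuclideanSpace ℝ (Fin n)) 1) with hω
  have hωt : ω ≠ ∞ := measure_ball_lt_top.ne
  obtain ⟨K, hK0, hK⟩ : ∃ K : ℕ, 0 < K ∧ ENNReal.ofReal (2 ^ n / (K : ℝ)) * ω < ε := by
    have h1 : Filter.Tendsto (fun K : ℕ => ENNReal.ofReal (2 ^ n / (K : ℝ)) * ω) Filter.atTop
        (nhds (ENNReal.ofReal 0 * ω)) :=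
      ENNReal.Tendsto.mul_const (ENNReal.tendsto_ofReal
        (tendsto_const_div_atTop_nhds_zero_nat _)) (Or.inr hωt)
    rw [ENNReal.ofReal_zero, zero_mul] at h1
    obtain ⟨K, h2, h3⟩ := ((h1.eventually (gt_mem_nhds (pos_iff_ne_zero.2 hε))).and
      (Filter.eventually_gt_atTop 0)).exists
    exact ⟨K, h3, h2⟩
  have hKr : (0 : ℝ) < K := by exact_mod_cast hK0
  refine ⟨2 ^ K, one_le_pow₀ one_le_two, fun x r hr => ?_⟩
  set W : ℕ → Set (EuclideanSpace ℝ (Fin n)) :=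
    fun k => {y | 2 ^ k * r ≤ dist y x ∧ dist y x < 2 ^ (k + 1) * r} with hW
  have hWm : ∀ k, MeasurableSet (W k) := fun k =>
    measurableSet_Ico.preimage (measurable_id.dist measurable_const)
  have hWd : ∀ {y j k}, y ∈ W j → y ∈ W k → j ≤ k := fun {y j k} hj hk => by
    by_contra! hlt
    have h1 : (2 : ℝ) ^ (k + 1) ≤ 2 ^ j := pow_le_pow_right₀ one_le_two hlt
    have h2 := mul_le_mul_of_nonneg_right h1 hr.le
    linarith [hj.1, hk.2]
  set a : ℕ → ℝ := fun k => (K * (2 ^ k * r))⁻¹ with ha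
  set σ : EuclideanSpace ℝ (Fin n) → ℝ≥0∞ :=
    fun y => ∑ k ∈ Finset.range K, (W k).indicator (fun _ => ENNReal.ofReal (a k)) y with hσ
  have hindm : ∀ k, Measurable ((W k).indicator (fun _ => ENNReal.ofReal (a k))) := fun k =>
    measurable_const.indicator (hWm k)
  have hσm : Measurable σ := Finset.measurable_sum _ fun k _ => hindm k
  refine ⟨σ, hσm, ?_, fun c hc1 hc2 => ?_⟩
  · have hpt : ∀ y, σ y ^ n ≤
        ∑ k ∈ Finset.range K, (W k).indicator (fun _ => ENNReal.ofReal (a k) ^ n) y := by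
      intro y
      by_cases hy : ∃ j ∈ Finset.range K, y ∈ W j
      · obtain ⟨j, hj, hyj⟩ := hy
        have : σ y = ENNReal.ofReal (a j) := by
          rw [hσ]
          simp only
          rw [Finset.sum_eq_single j, indicator_of_mem hyj]
          · exact fun k _ hkj => indicator_of_notMem
              (fun hyk => hkj (le_antisymm (hWd hyk hyj) (hWd hyj hyk))) _
          · exact fun h => absurd hj h
        rw [this]
        refine le_trans ?_ (Finset.single_le_sum (fun _ _ => zero_le) hj)
        rw [indicator_of_mem hyj]
      · push Not at hy
        have : σ y = 0 := Finset.sum_eq_zero fun k hk => indicator_of_notMem (hy k hk) _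
        rw [this, zero_pow (by omega)]
        exact zero_le
    calc ∫⁻ y, σ y ^ n
        ≤ ∫⁻ y, ∑ k ∈ Finset.range K, (W k).indicator (fun _ => ENNReal.ofReal (a k) ^ n) y :=
          lintegral_mono hpt
      _ = ∑ k ∈ Finset.range K, ENNReal.ofReal (a k) ^ n * volume (W k) := by
          rw [lintegral_finsetSum _ fun k _ => measurable_const.indicator (hWm k)]
          exact Finset.sum_congr rfl fun k _ => lintegral_indicator_const (hWm k) _
      _ ≤ ∑ k ∈ Finset.range K, ENNReal.ofReal ((2 / K) ^ n) * ω := by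
          refine Finset.sum_le_sum fun k _ => ?_
          calc ENNReal.ofReal (a k) ^ n * volume (W k)
              ≤ ENNReal.ofReal (a k) ^ n * volume (Metric.ball x (2 ^ (k + 1) * r)) := by
                gcongr
                exact fun y hy => hy.2
            _ = _ := by
                rw [volume_ball_eq x (by positivity), ← mul_assoc,
                  ← ENNReal.ofReal_pow (by positivity), ← ENNReal.ofReal_mul (by positivity),
                  ← mul_pow]
                congr 3
                rw [ha, pow_succ]
                field_simp
      _ = ENNReal.ofReal (K * (2 / K) ^ n) * ω := by
          rw [Finset.sum_const, Finset.card_range, nsmul_eq_mul, ENNReal.ofReal_mul hKr.le,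
            ENNReal.ofReal_natCast, mul_assoc]
      _ ≤ ENNReal.ofReal (2 ^ n / K) * ω := by
          gcongr
          rw [div_pow, ← mul_div_assoc, div_le_div_iff₀ (by positivity) hKr]
          have : (K : ℝ) ^ 2 ≤ K ^ n :=
            pow_le_pow_right₀ (by exact_mod_cast hK0) hn
          have := mul_le_mul_of_nonneg_left this (show (0 : ℝ) ≤ 2 ^ n by positivity)
          linarith
      _ ≤ ε := hK.le
  · have hcm : Measurable c.toFun := c.lip.continuous.measurable
    have hcost : c.cost σ = ∑ k ∈ Finset.range K,
        c.cost ((W k).indicator (fun _ => ENNReal.ofReal (a k))) :=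
      lintegral_finsetSum _ fun k _ => (hindm k).comp hcm
    have hone : ∀ k ∈ Finset.range K, ENNReal.ofReal (1 / K) ≤
        c.cost ((W k).indicator (fun _ => ENNReal.ofReal (a k))) := by
      intro k hk
      refine le_trans (le_of_eq ?_) (c.mul_ofReal_sub_le_cost' (x := x) (r₁ := 2 ^ k * r)
        (r₂ := 2 ^ (k + 1) * r) (k := ENNReal.ofReal (a k)) ?_ ?_ ?_)
      · rw [← ENNReal.ofReal_mul (by positivity)]
        congr 1
        rw [ha, pow_succ]
        field_simp
        ring
      · exact hc1.trans (le_mul_of_one_le_left hr.le (one_le_pow₀ one_le_two))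
      · obtain ⟨y, hy, hyM⟩ := hc2
        refine ⟨y, hy, le_trans ?_ hyM⟩
        gcongr
        · exact one_le_two
        · exact Nat.succ_le_of_lt (Finset.mem_range.1 hk)
      · intro y h1 h2
        rw [indicator_of_mem (show y ∈ W k from ⟨h1, h2⟩)]
    rw [hcost]
    refine le_trans (le_of_eq ?_) (Finset.sum_le_sum hone)
    rw [Finset.sum_const, Finset.card_range, nsmul_eq_mul, ← ENNReal.ofReal_natCast,
      ← ENNReal.ofReal_mul hKr.le, mul_one_div_cancel hKr.ne', ENNReal.ofReal_one]

/-- In dimension at least two, the paths from a point to a compact set not containing it form a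
family of modulus zero. -/
lemma lipModulus_eq_zero_of_subsingleton (hn : 2 ≤ n)
    (P : Set (EuclideanSpace ℝ (Fin n)) → Prop) {F₁ F₂ : Set (EuclideanSpace ℝ (Fin n))}
    (h₁ : IsContinuum F₁) (h₂ : IsContinuum F₂) (hdisj : Disjoint F₁ F₂)
    (h : F₁.Subsingleton ∨ F₂.Subsingleton) : lipModulus P F₁ F₂ = 0 := by
  by_contra hne
  obtain ⟨ε, hε0, hεlt⟩ := exists_between (pos_iff_ne_zero.2 hne)
  obtain ⟨M, hM, hesc⟩ := exists_weight_of_escape hn hε0.ne'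
  have hM0 : 0 < M := by linarith
  obtain ⟨x, F, hF, hxF, hends⟩ : ∃ (x : EuclideanSpace ℝ (Fin n))
      (F : Set (EuclideanSpace ℝ (Fin n))), IsContinuum F ∧ x ∉ F ∧
      ((F₁ = {x} ∧ F₂ = F) ∨ (F₁ = F ∧ F₂ = {x})) := by
    rcases h with h | h
    · obtain ⟨x, hx⟩ := h₁.2.nonempty
      exact ⟨x, F₂, h₂, fun hx' => hdisj.ne_of_mem hx hx' rfl,
        Or.inl ⟨h.eq_singleton_of_mem hx, rfl⟩⟩
    · obtain ⟨x, hx⟩ := h₂.2.nonempty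
      exact ⟨x, F₁, h₁, fun hx' => hdisj.ne_of_mem hx' hx rfl,
        Or.inr ⟨rfl, h.eq_singleton_of_mem hx⟩⟩
  have hd : 0 < Metric.infDist x F := (hF.1.isClosed.notMem_iff_infDist_pos hF.2.nonempty).1 hxF
  obtain ⟨σ, hσm, hσ, hesc⟩ := hesc x (Metric.infDist x F / M) (by positivity)
  have hfar : ∀ y ∈ F, M * (Metric.infDist x F / M) ≤ dist y x := fun y hy => by
    rw [mul_div_cancel₀ _ hM0.ne', dist_comm]
    exact Metric.infDist_le_dist_of_mem hy
  refine absurd (LipAdmissible.lipModulus_le (P := P) (ρ := σ) ⟨hσm, fun c hc1 hc2 _ => ?_⟩)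
    (not_le.2 (hσ.trans_lt hεlt))
  rcases hends with ⟨rfl, rfl⟩ | ⟨rfl, rfl⟩
  · rw [mem_singleton_iff] at hc1
    exact hesc c (by rw [hc1, dist_self]; positivity) ⟨_, c.target_mem_trace, hfar _ hc2⟩
  · rw [mem_singleton_iff] at hc2
    rw [← c.cost_reverse]
    exact hesc c.reverse (by rw [c.source_reverse, hc2, dist_self]; positivity)
      ⟨c.source, by rw [c.trace_reverse]; exact c.source_mem_trace, hfar _ hc1⟩

/-! ### Consequences of a Loewner-type bound for good paths -/

/-- An ideal of sets, those that are regarded as meeting `E` only negligibly. -/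
structure IsNegligibleIdeal (E : Set (EuclideanSpace ℝ (Fin n)))
    (P : Set (EuclideanSpace ℝ (Fin n)) → Prop) : Prop where
  mono : ∀ ⦃A B⦄, A ⊆ B → P B → P A
  union : ∀ ⦃A B⦄, P A → P B → P (A ∪ B)
  of_disjoint : ∀ ⦃A⦄, Disjoint A E → P A
  countable : ∀ ⦃A⦄, P A → (A ∩ E).Countable

lemma isNegligibleIdeal_disjoint (E : Set (EuclideanSpace ℝ (Fin n))) :
    IsNegligibleIdeal E (fun A => Disjoint A E) where
  mono _ _ h hB := hB.mono_left h
  union _ _ hA hB := hA.union_left hB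
  of_disjoint _ h := h
  countable _ h := by simp [h.inter_eq]

lemma isNegligibleIdeal_countable (E : Set (EuclideanSpace ℝ (Fin n))) :
    IsNegligibleIdeal E (fun A => (A ∩ E).Countable) where
  mono _ _ h hB := hB.mono (inter_subset_inter_left _ h)
  union A B hA hB := by rw [union_inter_distrib_right]; exact hA.union hB
  of_disjoint _ h := by simp [h.inter_eq]
  countable _ h := h

/-- The modulus of the family of paths with property `P` that join two non-degenerate disjoint
continua is bounded below in terms of the relative distance. -/
def HasLoewnerBound (P : Set (EuclideanSpace ℝ (Fin n)) → Prop) : Prop :=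
  ∀ t : ℝ, 0 < t → ∃ φ : ℝ, 0 < φ ∧ ∀ F₁ F₂ : Set (EuclideanSpace ℝ (Fin n)),
    IsContinuum F₁ → IsContinuum F₂ → F₁.Nontrivial → F₂.Nontrivial → Disjoint F₁ F₂ →
    relativeDistance F₁ F₂ ≤ t → ENNReal.ofReal φ ≤ lipModulus P F₁ F₂

lemma relativeDistance_le {F₁ F₂ : Set (EuclideanSpace ℝ (Fin n))} (h₁ : IsContinuum F₁)
    (h₂ : IsContinuum F₂) {a b : EuclideanSpace ℝ (Fin n)} (ha : a ∈ F₁) (hb : b ∈ F₂) {t r : ℝ}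
    (hr : 0 < r) (hab : dist a b ≤ t * r) (hr₁ : ∃ u ∈ F₁, ∃ v ∈ F₁, r ≤ dist u v)
    (hr₂ : ∃ u ∈ F₂, ∃ v ∈ F₂, r ≤ dist u v) : relativeDistance F₁ F₂ ≤ t := by
  obtain ⟨u, hu, v, hv, huv⟩ := hr₁
  obtain ⟨u', hu', v', hv', huv'⟩ := hr₂
  have hmin : r ≤ min (Metric.diam F₁) (Metric.diam F₂) :=
    le_min (huv.trans (Metric.dist_le_diam_of_mem h₁.1.isBounded hu hv))
      (huv'.trans (Metric.dist_le_diam_of_mem h₂.1.isBounded hu' hv'))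
  have hinf : sInf (image2 dist F₁ F₂) ≤ dist a b := by
    refine csInf_le ⟨0, ?_⟩ (mem_image2_of_mem ha hb)
    rintro _ ⟨x, _, y, _, rfl⟩
    exact dist_nonneg
  have ht : 0 ≤ t := nonneg_of_mul_nonneg_left (dist_nonneg.trans hab) hr
  rw [relativeDistance, div_le_iff₀ (hr.trans_le hmin)]
  exact hinf.trans (hab.trans (mul_le_mul_of_nonneg_left hmin ht))

lemma nontrivial_of_le_dist {F : Set (EuclideanSpace ℝ (Fin n))} {r : ℝ} (hr : 0 < r)
    (h : ∃ u ∈ F, ∃ v ∈ F, r ≤ dist u v) : F.Nontrivial := by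
  obtain ⟨u, hu, v, hv, huv⟩ := h
  exact ⟨u, hu, v, hv, dist_pos.1 (hr.trans_le huv)⟩

lemma isContinuum_closedBall (x : EuclideanSpace ℝ (Fin n)) {r : ℝ} (hr : 0 ≤ r) :
    IsContinuum (Metric.closedBall x r) :=
  ⟨isCompact_closedBall x r, (convex_closedBall x r).isConnected ⟨x, Metric.mem_closedBall_self hr⟩⟩

lemma exists_dist_eq (hn : n ≠ 0) (x : EuclideanSpace ℝ (Fin n)) {r : ℝ} (hr : 0 ≤ r) :
    ∃ y, dist x y = r :=
  ⟨x + r • EuclideanSpace.single ⟨0, Nat.pos_of_ne_zero hn⟩ 1, by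
    simp [norm_smul, abs_of_nonneg hr]⟩

lemma exists_le_dist_closedBall (hn : n ≠ 0) (x : EuclideanSpace ℝ (Fin n)) {r : ℝ} (hr : 0 ≤ r) :
    ∃ u ∈ Metric.closedBall x r, ∃ v ∈ Metric.closedBall x r, r ≤ dist u v := by
  obtain ⟨y, hy⟩ := exists_dist_eq hn x hr
  exact ⟨x, Metric.mem_closedBall_self hr, y, by rw [Metric.mem_closedBall', hy], hy.ge⟩

lemma disjoint_closedBall_of_dist_eq {x y : EuclideanSpace ℝ (Fin n)} {r : ℝ} (hr : 0 < r)
    (h : dist x y = 4 * r) : Disjoint (Metric.closedBall x r) (Metric.closedBall y r) :=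
  Metric.closedBall_disjoint_closedBall (by linarith)

section
variable {E : Set (EuclideanSpace ℝ (Fin n))} {P : Set (EuclideanSpace ℝ (Fin n)) → Prop}

lemma IsNegligibleIdeal.countable_trace (hP : IsNegligibleIdeal E P) {c : LipPath n}
    (hc : P c.inner) : (c.trace ∩ E).Countable := by
  refine Countable.mono ?_ (((hP.countable hc).insert c.target).insert c.source)
  rintro y ⟨hy, hyE⟩
  rcases c.trace_subset hy with h | h | h
  · exact Or.inl h
  · exact Or.inr (Or.inl h)
  · exact Or.inr (Or.inr ⟨h, hyE⟩)

/-- If the good paths satisfy a Loewner-type bound then `E` is a null set: near a density point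
of `E`, the function `1 / r` on the complement of `E` would be admissible with small mass. -/
lemma HasLoewnerBound.volume_eq_zero (hn : n ≠ 0) (hE : IsClosed E) (hP : IsNegligibleIdeal E P)
    (hL : HasLoewnerBound P) : volume E = 0 := by
  by_contra hne
  have : (ae (volume.restrict E)).NeBot := ae_restrict_neBot.2 hne
  obtain ⟨x, hx⟩ := (Besicovitch.ae_tendsto_measure_inter_div volume E).exists
  set ω := volume (Metric.ball (0 : EuclideanSpace ℝ (Fin n)) 1) with hω
  have hωt : ω ≠ ∞ := measure_ball_lt_top.ne
  obtain ⟨φ, hφ, hmod⟩ := hL 4 (by norm_num)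
  have hcompl : Filter.Tendsto (fun r => volume (Metric.closedBall x r \ E) /
      volume (Metric.closedBall x r)) (nhdsWithin 0 (Ioi 0)) (nhds 0) := by
    have h1 := ENNReal.Tendsto.sub (tendsto_const_nhds (x := (1 : ℝ≥0∞))) hx
      (Or.inl ENNReal.one_ne_top)
    rw [tsub_self] at h1
    refine h1.congr' ?_
    filter_upwards [self_mem_nhdsWithin] with r hr
    have h0 : volume (Metric.closedBall x r) ≠ 0 :=
      (Metric.measure_closedBall_pos _ _ hr).ne'
    have ht : volume (Metric.closedBall x r) ≠ ∞ := measure_closedBall_lt_top.ne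
    have hdiff := measure_inter_add_sdiff (μ := volume) (Metric.closedBall x r) hE.measurableSet
    rw [inter_comm] at hdiff
    refine ENNReal.sub_eq_of_eq_add ?_ ?_
    · exact ENNReal.div_ne_top (ne_top_of_le_ne_top ht (measure_mono inter_subset_right)) h0
    · rw [← ENNReal.add_div, add_comm, hdiff, ENNReal.div_self h0 ht]
  have hscale : Filter.Tendsto (fun r : ℝ => 2 * r) (nhdsWithin 0 (Ioi 0))
      (nhdsWithin 0 (Ioi 0)) := by
    refine tendsto_nhdsWithin_iff.2 ⟨?_, ?_⟩
    · have : Filter.Tendsto (fun r : ℝ => 2 * r) (nhds 0) (nhds (2 * 0)) := by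
        exact (continuous_const.mul continuous_id).tendsto 0
      rw [mul_zero] at this
      exact this.mono_left nhdsWithin_le_nhds
    · filter_upwards [self_mem_nhdsWithin] with r hr
      simpa using hr
  have hlim : Filter.Tendsto (fun r : ℝ => volume (Metric.closedBall x (2 * r) \ E) /
      volume (Metric.closedBall x (2 * r)) * (ENNReal.ofReal (2 ^ n) * ω))
      (nhdsWithin 0 (Ioi 0)) (nhds (0 * (ENNReal.ofReal (2 ^ n) * ω))) :=
    ENNReal.Tendsto.mul_const (hcompl.comp hscale)
      (Or.inr (ENNReal.mul_ne_top ENNReal.ofReal_ne_top hωt))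
  rw [zero_mul] at hlim
  obtain ⟨r, hrlt, hr⟩ := ((hlim.eventually (gt_mem_nhds (ENNReal.ofReal_pos.2 hφ))).and
    self_mem_nhdsWithin).exists
  have hr : 0 < r := hr
  obtain ⟨y, hy⟩ := exists_dist_eq hn x (show 0 ≤ 4 * r by positivity)
  set W := Metric.closedBall x (2 * r) \ E with hW
  have hWm : MeasurableSet W := Metric.isClosed_closedBall.measurableSet.diff hE.measurableSet
  have hadm : LipAdmissible P (Metric.closedBall x r) (Metric.closedBall y r)
      (W.indicator fun _ => ENNReal.ofReal r⁻¹) := by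
    refine ⟨measurable_const.indicator hWm, fun c hc1 hc2 hc => ?_⟩
    refine le_trans (le_of_eq ?_) (c.mul_ofReal_sub_le_cost (x := x) (r₁ := r) (r₂ := 2 * r)
      (k := ENNReal.ofReal r⁻¹) hc1 ⟨_, c.target_mem_trace, ?_⟩ (hP.countable_trace hc) ?_)
    · rw [← ENNReal.ofReal_mul (by positivity), two_mul, add_sub_cancel_right,
        inv_mul_cancel₀ hr.ne', ENNReal.ofReal_one]
    · have := dist_triangle x c.target y
      rw [Metric.mem_closedBall] at hc2
      rw [dist_comm]
      linarith
    · intro z _ h2 hz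
      rw [indicator_of_mem (show z ∈ W from ⟨h2.le, hz⟩)]
  have h1 := (hmod _ _ (isContinuum_closedBall x hr.le) (isContinuum_closedBall y hr.le)
    (nontrivial_of_le_dist hr (exists_le_dist_closedBall hn x hr.le))
    (nontrivial_of_le_dist hr (exists_le_dist_closedBall hn y hr.le))
    (disjoint_closedBall_of_dist_eq hr hy)
    (relativeDistance_le (isContinuum_closedBall x hr.le) (isContinuum_closedBall y hr.le)
      (Metric.mem_closedBall_self hr.le) (Metric.mem_closedBall_self hr.le) hr hy.le
      (exists_le_dist_closedBall hn x hr.le) (exists_le_dist_closedBall hn y hr.le))).trans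
    hadm.lipModulus_le
  refine absurd (h1.trans_lt ?_) (lt_irrefl _)
  refine lt_of_eq_of_lt ?_ hrlt
  have hpow : ∀ z, (W.indicator (fun _ => ENNReal.ofReal r⁻¹) z) ^ n =
      W.indicator (fun _ => ENNReal.ofReal r⁻¹ ^ n) z := fun z => by
    by_cases hz : z ∈ W <;> simp [hz, hn]
  simp only [hpow]
  rw [lintegral_indicator_const hWm, Measure.addHaar_closedBall _ _ (by positivity),
    finrank_euclideanSpace_fin, mul_pow, ENNReal.ofReal_mul (by positivity), ← hω,
    ENNReal.ofReal_inv_of_pos hr, ← ENNReal.inv_pow, ← ENNReal.ofReal_pow hr.le]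
  have hr0 : ENNReal.ofReal (r ^ n) ≠ 0 := by simp; positivity
  have h2 : ENNReal.ofReal (2 ^ n) * ω ≠ 0 :=
    mul_ne_zero (by simp) (Metric.measure_ball_pos _ _ one_pos).ne'
  rw [mul_comm (ENNReal.ofReal (2 ^ n)), mul_assoc, ENNReal.div_eq_inv_mul,
    ENNReal.mul_inv (Or.inl hr0) (Or.inl ENNReal.ofReal_ne_top), mul_right_comm,
    mul_assoc (ENNReal.ofReal (r ^ n))⁻¹,
    ENNReal.inv_mul_cancel h2 (ENNReal.mul_ne_top ENNReal.ofReal_ne_top hωt), mul_one]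

end

section
variable {E : Set (EuclideanSpace ℝ (Fin n))} {P : Set (EuclideanSpace ℝ (Fin n)) → Prop}

/-- The `Lⁿ` norm of `ρ` on the ball of center `x` and radius `r`. -/
noncomputable def localNorm (ρ : EuclideanSpace ℝ (Fin n) → ℝ≥0∞) (x : EuclideanSpace ℝ (Fin n))
    (r : ℝ) : ℝ≥0∞ :=
  (∫⁻ y in Metric.ball x r, ρ y ^ n) ^ (1 / (n : ℝ))

lemma localNorm_mono (ρ : EuclideanSpace ℝ (Fin n) → ℝ≥0∞) {x y : EuclideanSpace ℝ (Fin n)}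
    {r s : ℝ} (h : Metric.ball x r ⊆ Metric.ball y s) : localNorm ρ x r ≤ localNorm ρ y s :=
  ENNReal.rpow_le_rpow (lintegral_mono_set h) (by positivity)

lemma localNorm_pow (hn : n ≠ 0) (ρ : EuclideanSpace ℝ (Fin n) → ℝ≥0∞)
    (x : EuclideanSpace ℝ (Fin n)) (r : ℝ) :
    localNorm ρ x r ^ n = ∫⁻ y in Metric.ball x r, ρ y ^ n := by
  rw [localNorm, ← ENNReal.rpow_natCast, ← ENNReal.rpow_mul, one_div_mul_cancel
    (by exact_mod_cast hn), ENNReal.rpow_one]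

/-- Two continua of size at least `r` within distance comparable to `r` of a point are joined by a
good path that stays within a comparable distance of the point and whose cost is controlled by the
local `Lⁿ` norm. Otherwise `ρ`, normalized and cut off, would be admissible together with a function
of small norm that takes care of the escaping paths. -/
lemma HasLoewnerBound.exists_lipPath (hn : 2 ≤ n) (hL : HasLoewnerBound P) {R : ℝ}
    (hR : 1 ≤ R) :
    ∃ M, R ≤ M ∧ ∃ C : ℝ, 0 < C ∧ ∀ ρ : EuclideanSpace ℝ (Fin n) → ℝ≥0∞, Measurable ρ →
      ∀ (x : EuclideanSpace ℝ (Fin n)) (r : ℝ), 0 < r → ∀ K₁ K₂ : Set (EuclideanSpace ℝ (Fin n)),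
        IsContinuum K₁ → IsContinuum K₂ → Disjoint K₁ K₂ → K₁ ⊆ Metric.closedBall x (R * r) →
        (∃ z ∈ K₂, dist z x ≤ R * r) → (∃ u ∈ K₁, ∃ v ∈ K₁, r ≤ dist u v) →
        (∃ u ∈ K₂, ∃ v ∈ K₂, r ≤ dist u v) →
        ∃ c : LipPath n, c.source ∈ K₁ ∧ c.target ∈ K₂ ∧ P c.inner ∧
          c.trace ⊆ Metric.ball x (M * r) ∧
          c.cost ρ ≤ ENNReal.ofReal C * localNorm ρ x (M * r) := by
  have hn0 : n ≠ 0 := by omega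
  obtain ⟨φ, hφ, hmod⟩ := hL (2 * R) (by linarith)
  obtain ⟨M, hM, hesc⟩ := exists_weight_of_escape hn (ε := ENNReal.ofReal (φ / 4)) (by simpa)
  -- The constant is chosen such that `C⁻ⁿ ≤ φ / 4`, so that both test functions below have norm at
  -- most `φ / 4`.
  set C : ℝ := max 1 (4 / φ) with hC
  have hC1 : 1 ≤ C := le_max_left _ _
  have hC0 : 0 < C := by linarith
  have hCφ : ENNReal.ofReal (C ^ n)⁻¹ ≤ ENNReal.ofReal (φ / 4) := by
    refine ENNReal.ofReal_le_ofReal ((inv_anti₀ hC0 (le_self_pow₀ hC1 hn0)).trans ?_)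
    rw [inv_le_comm₀ hC0 (by positivity), inv_div]
    exact le_max_right _ _
  refine ⟨M * R, le_mul_of_one_le_left (by linarith) hM, C, hC0,
    fun ρ hρ x r hr K₁ K₂ h₁ h₂ hdisj hK₁ hK₂ hr₁ hr₂ => ?_⟩
  by_contra! hcon
  set B := Metric.ball x (M * R * r) with hB
  have hBm : MeasurableSet B := Metric.isOpen_ball.measurableSet
  set k : ℝ≥0∞ := ENNReal.ofReal C * localNorm ρ x (M * R * r) with hk
  obtain ⟨σ, hσm, hσ, hesc⟩ := hesc x (R * r) (by positivity)
  set h : EuclideanSpace ℝ (Fin n) → ℝ≥0∞ := B.indicator fun y => k⁻¹ * ρ y with hh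
  have hhm : Measurable h := (hρ.const_mul _).indicator hBm
  have hadm : LipAdmissible P K₁ K₂ fun y => max (h y) (σ y) := by
    refine ⟨hhm.max hσm, fun c hc1 hc2 hc => ?_⟩
    by_cases hin : c.trace ⊆ B
    · refine le_trans ?_ (c.cost_mono fun y => le_max_left (h y) (σ y))
      have hcost : c.cost h = k⁻¹ * c.cost ρ := by
        have hm : Measurable fun t => ρ (c.toFun t) := hρ.comp c.lip.continuous.measurable
        rw [LipPath.cost, LipPath.cost, ← lintegral_const_mul _ hm]
        refine setLIntegral_congr_fun measurableSet_Ioc fun t ht => ?_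
        rw [hh]
        exact indicator_of_mem (hin ⟨t, Ioc_subset_Icc_self ht, rfl⟩) _
      have hlt := hcon c hc1 hc2 hc hin
      have hkt : k ≠ ∞ := hlt.ne_top
      rw [hcost]
      rcases eq_or_ne k 0 with h0 | h0
      · rw [h0] at hlt ⊢
        rw [ENNReal.inv_zero, ENNReal.top_mul hlt.ne']
        exact le_top
      · rw [← ENNReal.inv_mul_cancel h0 hkt]
        gcongr
    · obtain ⟨y, hy, hyB⟩ := not_subset.1 hin
      refine le_trans ?_ (c.cost_mono fun y => le_max_right (h y) (σ y))
      refine hesc c (hK₁ hc1) ⟨y, hy, ?_⟩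
      rw [← mul_assoc]
      exact not_lt.1 hyB
  have hint : ∫⁻ y, h y ^ n ≤ ENNReal.ofReal (φ / 4) := by
    refine le_trans ?_ hCφ
    have h1 : ∀ y, h y ^ n = B.indicator (fun y => (k⁻¹) ^ n * ρ y ^ n) y := fun y => by
      by_cases hy : y ∈ B <;> simp [hh, hy, hn0, mul_pow]
    simp only [h1]
    rw [lintegral_indicator hBm, lintegral_const_mul _ (hρ.pow_const n), ← localNorm_pow hn0,
      ← ENNReal.inv_pow, hk, mul_pow]
    have hCn : ENNReal.ofReal C ^ n ≠ 0 := pow_ne_zero _ (by simpa using hC0)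
    have hCt : ENNReal.ofReal C ^ n ≠ ∞ := ENNReal.pow_ne_top ENNReal.ofReal_ne_top
    rw [ENNReal.mul_inv (Or.inl hCn) (Or.inl hCt), mul_assoc, ENNReal.ofReal_inv_of_pos
      (by positivity), ENNReal.ofReal_pow hC0.le]
    exact mul_le_of_le_one_right' (ENNReal.inv_mul_le_one _)
  obtain ⟨z, hz, hzx⟩ := hK₂
  obtain ⟨w, hw⟩ := h₁.2.nonempty
  have hwz : dist w z ≤ 2 * R * r := by
    have := dist_triangle_right w z x
    have := Metric.mem_closedBall.1 (hK₁ hw)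
    linarith
  have hfinal := (hmod K₁ K₂ h₁ h₂ (nontrivial_of_le_dist hr hr₁) (nontrivial_of_le_dist hr hr₂)
    hdisj (relativeDistance_le h₁ h₂ hw hz hr hwz hr₁ hr₂)).trans hadm.lipModulus_le
  refine absurd hfinal (not_le.2 ?_)
  calc ∫⁻ y, max (h y) (σ y) ^ n ≤ ∫⁻ y, (h y ^ n + σ y ^ n) := by
        refine lintegral_mono fun y => ?_
        rcases max_choice (h y) (σ y) with h' | h' <;> rw [h']
        · exact le_self_add
        · exact le_add_self
    _ = (∫⁻ y, h y ^ n) + ∫⁻ y, σ y ^ n := lintegral_add_left (hhm.pow_const n) _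
    _ ≤ ENNReal.ofReal (φ / 4) + ENNReal.ofReal (φ / 4) := add_le_add hint hσ
    _ < ENNReal.ofReal φ := by
        rw [← ENNReal.ofReal_add (by positivity) (by positivity)]
        exact (ENNReal.ofReal_lt_ofReal_iff hφ).2 (by linarith)

/-- Near every point and at every scale there is a path that is good up to its endpoints and whose
cost is controlled by the local `Lⁿ` norm. -/
lemma HasLoewnerBound.exists_lipPath_trace (hn : 2 ≤ n) (hP : IsNegligibleIdeal E P)
    (hL : HasLoewnerBound P) :
    ∃ M, 1 ≤ M ∧ ∃ C : ℝ, 0 < C ∧ ∀ ρ : EuclideanSpace ℝ (Fin n) → ℝ≥0∞, Measurable ρ →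
      ∀ (x : EuclideanSpace ℝ (Fin n)) (r : ℝ), 0 < r →
        ∃ c : LipPath n, P c.trace ∧ c.trace ⊆ Metric.ball x (M * r) ∧
          (∃ u ∈ c.trace, ∃ v ∈ c.trace, r ≤ dist u v) ∧
          c.cost ρ ≤ ENNReal.ofReal C * localNorm ρ x (M * r) := by
  have hn0 : n ≠ 0 := by omega
  obtain ⟨M, hM, C, hC, H⟩ := hL.exists_lipPath hn (R := 4) (by norm_num)
  refine ⟨M, by linarith, C, hC, fun ρ hρ x r hr => ?_⟩
  obtain ⟨y, hy⟩ := exists_dist_eq hn0 x (show 0 ≤ 4 * r by positivity)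
  obtain ⟨c, hc1, hc2, hc, htr, hcost⟩ := H ρ hρ x r hr _ _ (isContinuum_closedBall x hr.le)
    (isContinuum_closedBall y hr.le) (disjoint_closedBall_of_dist_eq hr hy)
    (Metric.closedBall_subset_closedBall (by linarith))
    ⟨y, Metric.mem_closedBall_self hr.le, by rw [dist_comm, hy]⟩
    (exists_le_dist_closedBall hn0 x hr.le) (exists_le_dist_closedBall hn0 y hr.le)
  have hd : 2 * r ≤ dist c.source c.target := by
    have := dist_triangle4 x c.source c.target y
    rw [Metric.mem_closedBall'] at hc1
    rw [Metric.mem_closedBall] at hc2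
    linarith
  have hlen : 2 * r ≤ c.len := by
    have := c.dist_le 0 c.len
    rw [zero_sub, abs_neg, abs_of_nonneg c.len_nonneg] at this
    exact hd.trans this
  have hle : r / 2 ≤ c.len - r / 2 := by linarith
  have hsub : c.toFun '' Icc (r / 2) (c.len - r / 2) ⊆ c.inner :=
    image_mono fun t ht => ⟨by linarith [ht.1], by linarith [ht.2]⟩
  refine ⟨c.restrict _ _ hle, ?_, ?_, ?_, (c.cost_restrict_le hle (by linarith) (by linarith)
    ρ).trans hcost⟩ <;> rw [c.trace_restrict]
  · exact hP.mono hsub hc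
  · exact hsub.trans (c.inner_subset_trace.trans htr)
  · refine ⟨_, ⟨_, ⟨le_rfl, hle⟩, rfl⟩, _, ⟨_, ⟨hle, le_rfl⟩, rfl⟩, ?_⟩
    have h1 := c.dist_le 0 (r / 2)
    have h2 := c.dist_le (c.len - r / 2) c.len
    rw [zero_sub, abs_neg, abs_of_nonneg (by positivity)] at h1
    rw [sub_sub_cancel_left, abs_neg, abs_of_nonneg (by positivity)] at h2
    have := dist_triangle4 c.source (c.toFun (r / 2)) (c.toFun (c.len - r / 2)) c.target
    simp only [LipPath.source, LipPath.target] at this hd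
    linarith

/-! ### Dimension one -/

/-- On the line, a Loewner-type bound for good paths forces every path joining disjoint continua to
be good, up to shortening. -/
lemma lipModulus_le_of_dim_one (hn : n = 1) (hP : IsNegligibleIdeal E P) (hL : HasLoewnerBound P)
    {F₁ F₂ : Set (EuclideanSpace ℝ (Fin n))} (hdisj : Disjoint F₁ F₂) :
    lipModulus (fun _ => True) F₁ F₂ ≤ lipModulus P F₁ F₂ := by
  subst hn
  refine le_iInf₂ fun ρ hρ => LipAdmissible.lipModulus_le ⟨hρ.1, fun c hc1 hc2 _ => ?_⟩
  have hne : c.source ≠ c.target := fun h => hdisj.ne_of_mem hc1 hc2 h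
  obtain ⟨s, t, hs, hst, ht, hcs, hct, hav⟩ := c.exists_restrict_avoiding_endpoints hne
  refine (hρ.2 (c.restrict s t hst.le) (by rwa [c.source_restrict, hcs])
    (by rwa [c.target_restrict, hct]) ?_).trans (c.cost_restrict_le hst.le hs ht ρ)
  rw [c.inner_restrict]
  set p := c.source with hp
  set q := c.target with hq
  have hpq : 0 < dist p q := dist_pos.2 hne
  have hdist : ∀ x y : EuclideanSpace ℝ (Fin 1), dist x y = |x 0 - y 0| := fun x y => by
    rw [EuclideanSpace.dist_eq]
    simp [Real.sqrt_sq_eq_abs, Real.dist_eq]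
  have hd0 : q 0 - p 0 ≠ 0 := fun h => by
    rw [hdist, abs_sub_comm, h, abs_zero] at hpq
    exact lt_irrefl _ hpq
  -- The affine coordinate that is `0` at `p` and `1` at `q`.
  set f : EuclideanSpace ℝ (Fin 1) → ℝ := fun y => (y 0 - p 0) / (q 0 - p 0) with hf
  have hfc : Continuous f := by fun_prop
  have hinj : ∀ x y, f x = f y → x = y := fun x y h => by
    rw [hf] at h
    simp only [div_left_inj' hd0, sub_left_inj] at h
    ext i
    rwa [Subsingleton.elim i 0]
  have hfp : f p = 0 := by simp [hf]
  have hfq : f q = 1 := div_self hd0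
  have hfd : ∀ x y, dist x y = |f x - f y| * dist p q := fun x y => by
    rw [hdist, hdist p q, abs_sub_comm (p 0), ← abs_mul, hf]
    congr 1
    field_simp
    ring
  obtain ⟨φ, hφ, hmod⟩ := hL 1 one_pos
  set K₁ := Metric.closedBall (p - (q - p)) (dist p q) with hK₁
  set K₂ := Metric.closedBall (q + (q - p)) (dist p q) with hK₂
  have hf₁ : f (p - (q - p)) = -1 := by
    simp only [hf, PiLp.sub_apply]; field_simp; ring
  have hf₂ : f (q + (q - p)) = 2 := by
    simp only [hf, PiLp.sub_apply, PiLp.add_apply]; field_simp; ring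
  have hmem₁ : ∀ y, y ∈ K₁ ↔ |f y + 1| ≤ 1 := fun y => by
    rw [hK₁, Metric.mem_closedBall, hfd, hf₁, sub_neg_eq_add, mul_le_iff_le_one_left hpq]
  have hmem₂ : ∀ y, y ∈ K₂ ↔ |f y - 2| ≤ 1 := fun y => by
    rw [hK₂, Metric.mem_closedBall, hfd, hf₂, mul_le_iff_le_one_left hpq]
  have hK : Disjoint K₁ K₂ := by
    refine Set.disjoint_left.2 fun y h1 h2 => ?_
    rw [hmem₁, abs_le] at h1
    rw [hmem₂, abs_le] at h2
    linarith [h1.2, h2.1]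
  have hlow := hmod K₁ K₂ (isContinuum_closedBall _ hpq.le) (isContinuum_closedBall _ hpq.le)
    (nontrivial_of_le_dist hpq (exists_le_dist_closedBall one_ne_zero _ hpq.le))
    (nontrivial_of_le_dist hpq (exists_le_dist_closedBall one_ne_zero _ hpq.le)) hK
    (relativeDistance_le (isContinuum_closedBall _ hpq.le) (isContinuum_closedBall _ hpq.le)
      ((hmem₁ p).2 (by rw [hfp]; norm_num)) ((hmem₂ q).2 (by rw [hfq]; norm_num)) hpq
      (one_mul _).ge
      (exists_le_dist_closedBall one_ne_zero _ hpq.le)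
      (exists_le_dist_closedBall one_ne_zero _ hpq.le))
  -- There is a good path from `K₁` to `K₂`, and it covers the interval between `p` and `q`.
  obtain ⟨d, hd1, hd2, hd⟩ : ∃ d : LipPath 1, d.source ∈ K₁ ∧ d.target ∈ K₂ ∧ P d.inner := by
    by_contra! hcon
    have hadm : LipAdmissible P K₁ K₂ 0 :=
      ⟨measurable_zero, fun d h1 h2 h3 => absurd h3 (hcon d h1 h2)⟩
    have := hlow.trans hadm.lipModulus_le
    simp at this
    linarith
  refine hP.mono ?_ hd
  rintro _ ⟨u, hu, rfl⟩
  have hgc : Continuous fun w => f (c.toFun w) := hfc.comp c.lip.continuous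
  have hpos : 0 < f (c.toFun u) := by
    by_contra! hle
    obtain ⟨w, hw, hw0⟩ := intermediate_value_Icc hu.2.le hgc.continuousOn
      (show (0 : ℝ) ∈ Icc (f (c.toFun u)) (f (c.toFun t)) by
        rw [hct, hfq]; exact ⟨hle, zero_le_one⟩)
    have hwp : c.toFun w = p := hinj _ _ (hw0.trans hfp.symm)
    rcases hw.2.eq_or_lt with rfl | hwt
    · exact hne (hwp.symm.trans hct)
    · exact (hav w ⟨hu.1.trans_le hw.1, hwt⟩).1 hwp
  have hlt : f (c.toFun u) < 1 := by
    by_contra! hle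
    obtain ⟨w, hw, hw1⟩ := intermediate_value_Icc hu.1.le hgc.continuousOn
      (show (1 : ℝ) ∈ Icc (f (c.toFun s)) (f (c.toFun u)) by
        rw [hcs, hfp]; exact ⟨zero_le_one, hle⟩)
    have hwq : c.toFun w = q := hinj _ _ (hw1.trans hfq.symm)
    rcases hw.1.eq_or_lt with rfl | hsw
    · exact hne (hcs.symm.trans hwq)
    · exact (hav w ⟨hsw, hw.2.trans_lt hu.2⟩).2 hwq
  rw [hmem₁, abs_le] at hd1
  rw [hmem₂, abs_le] at hd2
  have hd1' : f (d.toFun 0) ≤ 0 := by linarith [hd1.2, show f (d.toFun 0) = f d.source from rfl]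
  have hd2' : 1 ≤ f (d.toFun d.len) := by
    linarith [hd2.1, show f (d.toFun d.len) = f d.target from rfl]
  obtain ⟨w, hw, hwu⟩ := intermediate_value_Icc d.len_nonneg
    (hfc.comp d.lip.continuous).continuousOn
    (show f (c.toFun u) ∈ Icc (f (d.toFun 0)) (f (d.toFun d.len)) from
      ⟨by linarith, by linarith⟩)
  simp only [Function.comp_apply] at hwu
  refine ⟨w, ⟨lt_of_le_of_ne hw.1 ?_, lt_of_le_of_ne hw.2 ?_⟩, hinj _ _ hwu⟩
  · rintro rfl; linarith
  · rintro rfl; linarith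

end

/-! ### Replacing a path by a good path -/


namespace LipPath

variable (c : LipPath n)

/-- The first exit from the closed ball of radius `r` around `c(s)`. -/
lemma exists_exit {s r : ℝ} (hr : 0 ≤ r)
    (h : ∃ t ∈ Icc s c.len, r < dist (c.toFun t) (c.toFun s)) :
    ∃ s' ∈ Icc s c.len, dist (c.toFun s') (c.toFun s) = r ∧
      ∀ u ∈ Icc s s', dist (c.toFun u) (c.toFun s) ≤ r := by
  obtain ⟨t, ht, htr⟩ := h
  have hc : Continuous fun u => dist (c.toFun u) (c.toFun s) :=
    c.lip.continuous.dist continuous_const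
  have hK : IsCompact (Icc s c.len ∩ {u | r ≤ dist (c.toFun u) (c.toFun s)}) :=
    isCompact_Icc.inter_right (isClosed_le continuous_const hc)
  obtain ⟨s', ⟨hs', hs'r⟩, hmin⟩ := hK.exists_isLeast ⟨t, ht, htr.le⟩
  obtain ⟨w, hw, hwr⟩ := intermediate_value_Icc hs'.1 hc.continuousOn
    (show r ∈ Icc _ _ from ⟨by simpa using hr, hs'r⟩)
  have hws : w = s' := le_antisymm hw.2 (hmin ⟨⟨hw.1, hw.2.trans hs'.2⟩, hwr.ge⟩)
  subst hws
  refine ⟨w, hs', hwr, fun u hu => ?_⟩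
  by_contra! hlt
  have := hmin ⟨⟨hu.1, hu.2.trans hs'.2⟩, hlt.le⟩
  rw [le_antisymm hu.2 this] at hlt
  exact absurd hwr hlt.ne'

lemma image_Ico_subset : c.toFun '' Ico 0 c.len ⊆ insert c.source c.inner := by
  rintro _ ⟨t, ht, rfl⟩
  rcases ht.1.eq_or_lt with rfl | h0
  · exact Or.inl rfl
  · exact Or.inr ⟨t, ⟨h0, ht.2⟩, rfl⟩

lemma image_Ico_subset_trace : c.toFun '' Ico 0 c.len ⊆ c.trace := image_mono Ico_subset_Icc_self

lemma inner_subset_image_Ico : c.inner ⊆ c.toFun '' Ico 0 c.len := image_mono Ioo_subset_Ico_self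

lemma image_Ioc_reverse : c.reverse.toFun '' Ioc 0 c.reverse.len = c.toFun '' Ico 0 c.len := by
  have : c.reverse.toFun = c.toFun ∘ (fun u => c.len - u) := rfl
  rw [this, image_comp]
  simp [reverse]

/-- Two points of the trace of a path can be joined inside the trace. -/
lemma exists_subpath {p q : EuclideanSpace ℝ (Fin n)} (hp : p ∈ c.trace) (hq : q ∈ c.trace) :
    ∃ e : LipPath n, e.source = p ∧ e.target = q ∧ e.trace ⊆ c.trace ∧
      ∀ ρ, e.cost ρ ≤ c.cost ρ := by
  obtain ⟨s, hs, rfl⟩ := hp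
  obtain ⟨t, ht, rfl⟩ := hq
  rcases le_total s t with h | h
  · refine ⟨c.restrict s t h, by simp, by simp, ?_, c.cost_restrict_le h hs.1 ht.2⟩
    rw [trace_restrict]
    exact image_mono (Icc_subset_Icc hs.1 ht.2)
  · refine ⟨(c.restrict t s h).reverse, by simp, by simp, ?_, fun ρ => ?_⟩
    · rw [trace_reverse, trace_restrict]
      exact image_mono (Icc_subset_Icc ht.1 hs.2)
    · rw [cost_reverse]
      exact c.cost_restrict_le h ht.1 hs.2 ρ

lemma image_Ico_concat_subset {c d : LipPath n} (h : c.target = d.source) :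
    (c.concat d).toFun '' Ico 0 (c.concat d).len ⊆ c.trace ∪ d.toFun '' Ico 0 d.len :=
  image_concat_subset h (fun _ hu h1 => ⟨hu.1, h1⟩)
    fun u hu h1 => ⟨by linarith, by linarith [hu.2.trans_eq (show _ = c.len + d.len from rfl)]⟩

end LipPath

section
variable {E : Set (EuclideanSpace ℝ (Fin n))} {P : Set (EuclideanSpace ℝ (Fin n)) → Prop}

/-- Small good paths between large enough continua, at scale `r`: near every point `x` there is a
good path of size at least `r` and any two continua of size at least `r` near `x` are joined by a
good path. The costs are at most `N x`. -/
structure HasLinks (P : Set (EuclideanSpace ℝ (Fin n)) → Prop)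
    (ρ : EuclideanSpace ℝ (Fin n) → ℝ≥0∞) (r Λ : ℝ) (N : EuclideanSpace ℝ (Fin n) → ℝ≥0∞) :
    Prop where
  link : ∀ x, ∃ c : LipPath n, P c.trace ∧ c.trace ⊆ Metric.closedBall x (Λ * r) ∧
    (∃ u ∈ c.trace, ∃ v ∈ c.trace, r ≤ dist u v) ∧ c.cost ρ ≤ N x
  join : ∀ x, ∀ K₁ K₂ : Set (EuclideanSpace ℝ (Fin n)), IsContinuum K₁ → IsContinuum K₂ →
    Disjoint K₁ K₂ → K₁ ⊆ Metric.closedBall x (Λ * r) → (∃ z ∈ K₂, dist z x ≤ (Λ + 1) * r) →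
    (∃ u ∈ K₁, ∃ v ∈ K₁, r ≤ dist u v) → (∃ u ∈ K₂, ∃ v ∈ K₂, r ≤ dist u v) →
    ∃ c : LipPath n, c.source ∈ K₁ ∧ c.target ∈ K₂ ∧ P c.inner ∧ c.cost ρ ≤ N x

variable {ρ : EuclideanSpace ℝ (Fin n) → ℝ≥0∞} {r Λ : ℝ} {N : EuclideanSpace ℝ (Fin n) → ℝ≥0∞}

/-- From any point of a good path `d` one can reach a nearby continuum `K` by a path that is good up
to its endpoint. Nothing has to be paid for the connection if `d` meets `K`. -/
lemma HasLinks.exists_connection (hP : IsNegligibleIdeal E P) (hN : HasLinks P ρ r Λ N)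
    {x : EuclideanSpace ℝ (Fin n)} {d : LipPath n} {K : Set (EuclideanSpace ℝ (Fin n))}
    (hd : P d.trace) (hdx : d.trace ⊆ Metric.closedBall x (Λ * r))
    (hdr : ∃ u ∈ d.trace, ∃ v ∈ d.trace, r ≤ dist u v) (hK : IsContinuum K)
    (hKx : ∃ z ∈ K, dist z x ≤ (Λ + 1) * r) (hKr : ∃ u ∈ K, ∃ v ∈ K, r ≤ dist u v)
    {k : ℝ≥0∞} (hk : Disjoint d.trace K → N x ≤ k) {p : EuclideanSpace ℝ (Fin n)}
    (hp : p ∈ d.trace) :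
    ∃ e : LipPath n, e.source = p ∧ e.target ∈ K ∧ P (e.toFun '' Ico 0 e.len) ∧
      e.cost ρ ≤ d.cost ρ + k := by
  by_cases hdis : Disjoint d.trace K
  · obtain ⟨b, hb1, hb2, hb, hbN⟩ := hN.join x _ _ d.isContinuum_trace hK hdis hdx hKx hdr hKr
    obtain ⟨e, he1, he2, he, hec⟩ := d.exists_subpath hp hb1
    refine ⟨e.concat b, by rw [LipPath.source_concat, he1], by rwa [LipPath.target_concat he2],
      hP.mono (LipPath.image_Ico_concat_subset he2) ?_, ?_⟩
    · refine hP.union (hP.mono he hd) (hP.mono b.image_Ico_subset ?_)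
      exact hP.mono (insert_subset (Or.inl hb1) subset_union_right) (hP.union hd hb)
    · rw [LipPath.cost_concat he2]
      exact add_le_add (hec ρ) (hbN.trans (hk hdis))
  · obtain ⟨q, hq1, hq2⟩ := Set.not_disjoint_iff.1 hdis
    obtain ⟨e, he1, he2, he, hec⟩ := d.exists_subpath hp hq1
    exact ⟨e, he1, by rwa [he2], hP.mono (e.image_Ico_subset_trace.trans he) hd,
      (hec ρ).trans le_self_add⟩

variable {G : EuclideanSpace ℝ (Fin n) → ℝ≥0∞} {η : ℝ≥0∞}

/-- The inductive construction of a good path near a given path `c`. Successive exit times from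
balls of radius `r` divide `c` into pieces. To a piece starting far from `E` the piece itself is
associated, to the others a small good path nearby, and good paths associated to successive pieces
are joined by further small good paths unless they intersect already. The small good paths are
paid for by the integral of `G` over the respective piece of `c`, except for the last one, which
costs `η`. -/
lemma HasLinks.exists_lipPath_aux (hP : IsNegligibleIdeal E P) (hr : 0 < r) (hΛ : 1 ≤ Λ)
    (hρ : Measurable ρ) (hGm : Measurable G)
    (hN : HasLinks P ρ r Λ N) (hη : ∀ x, N x ≤ η)
    (hG : ∀ x y, dist y x ≤ r → (Metric.closedBall x (2 * r) ∩ E).Nonempty →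
      N x * ENNReal.ofReal r⁻¹ ≤ G y)
    {F : Set (EuclideanSpace ℝ (Fin n))} (hF : IsContinuum F)
    (hFr : ∃ u ∈ F, ∃ v ∈ F, r ≤ dist u v) (c : LipPath n) (hcF : c.target ∈ F) (m : ℕ) :
    ∀ s, 0 ≤ s → s ≤ c.len → c.len - s ≤ m * r →
      (∃ t ∈ Icc s c.len, r < dist (c.toFun t) (c.toFun s)) →
      ∃ d : LipPath n, P d.trace ∧ d.trace ⊆ Metric.closedBall (c.toFun s) (Λ * r) ∧
        (∃ u ∈ d.trace, ∃ v ∈ d.trace, r ≤ dist u v) ∧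
        (Disjoint (Metric.closedBall (c.toFun s) r) E → c.toFun s ∈ d.trace) ∧
        ∀ p ∈ d.trace, ∃ e : LipPath n, e.source = p ∧ e.target ∈ F ∧
          P (e.toFun '' Ico 0 e.len) ∧
          e.cost ρ ≤ (∫⁻ t in Ioc s c.len, (ρ (c.toFun t) + 2 * G (c.toFun t))) + η := by
  induction m with
  | zero =>
    rintro s hs0 hsL hm ⟨t, ht, htr⟩
    have h1 : t = s := le_antisymm (by simp at hm; linarith [ht.2]) ht.1
    rw [h1, dist_self] at htr
    exact absurd htr (not_lt.2 hr.le)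
  | succ m ih =>
    intro s hs0 hsL hm hexit
    have hcm : Measurable c.toFun := c.lip.continuous.measurable
    have hρc : Measurable fun t => ρ (c.toFun t) := hρ.comp hcm
    have hGc : Measurable fun t => G (c.toFun t) := hGm.comp hcm
    obtain ⟨s', hs', hs'r, hball⟩ := c.exists_exit hr.le hexit
    have hlen : r ≤ s' - s := by
      have := c.dist_le s' s
      rw [hs'r, abs_of_nonneg (sub_nonneg.2 hs'.1)] at this
      exact this
    have hrΛ : r ≤ Λ * r := le_mul_of_one_le_left hr.le hΛ
    -- Near `E` the cost of a small good path is controlled by the integral of `G`.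
    have hpay : (Metric.closedBall (c.toFun s) (2 * r) ∩ E).Nonempty →
        N (c.toFun s) ≤ ∫⁻ t in Ioc s s', G (c.toFun t) := fun hne => by
      calc N (c.toFun s) = N (c.toFun s) * ENNReal.ofReal r⁻¹ * ENNReal.ofReal r := by
            rw [mul_assoc, ← ENNReal.ofReal_mul (by positivity), inv_mul_cancel₀ hr.ne',
              ENNReal.ofReal_one, mul_one]
        _ ≤ N (c.toFun s) * ENNReal.ofReal r⁻¹ * ENNReal.ofReal (s' - s) := by gcongr
        _ = ∫⁻ t in Ioc s s', N (c.toFun s) * ENNReal.ofReal r⁻¹ := by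
            rw [setLIntegral_const, Real.volume_Ioc]
        _ ≤ _ := setLIntegral_mono' measurableSet_Ioc fun t ht =>
            hG _ _ (hball t (Ioc_subset_Icc_self ht)) hne
    obtain ⟨d, hd, hdx, hdr, hdgood, hdcost⟩ : ∃ d : LipPath n, P d.trace ∧
        d.trace ⊆ Metric.closedBall (c.toFun s) (Λ * r) ∧
        (∃ u ∈ d.trace, ∃ v ∈ d.trace, r ≤ dist u v) ∧
        (Disjoint (Metric.closedBall (c.toFun s) r) E →
          c.toFun s ∈ d.trace ∧ c.toFun s' ∈ d.trace) ∧
        d.cost ρ ≤ ∫⁻ t in Ioc s s', (ρ (c.toFun t) + G (c.toFun t)) := by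
      by_cases hgood : Disjoint (Metric.closedBall (c.toFun s) r) E
      · have htr : (c.restrict s s' hs'.1).trace ⊆ Metric.closedBall (c.toFun s) r := by
          rw [c.trace_restrict]
          rintro _ ⟨t, ht, rfl⟩
          exact hball t ht
        have h1 : c.toFun s ∈ (c.restrict s s' hs'.1).trace := by
          rw [c.trace_restrict]; exact ⟨s, ⟨le_rfl, hs'.1⟩, rfl⟩
        have h2 : c.toFun s' ∈ (c.restrict s s' hs'.1).trace := by
          rw [c.trace_restrict]; exact ⟨s', ⟨hs'.1, le_rfl⟩, rfl⟩
        refine ⟨c.restrict s s' hs'.1, hP.of_disjoint (hgood.mono_left htr),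
          htr.trans (Metric.closedBall_subset_closedBall hrΛ), ⟨_, h2, _, h1, hs'r.ge⟩,
          fun _ => ⟨h1, h2⟩, ?_⟩
        rw [c.cost_restrict]
        exact lintegral_mono fun t => le_self_add
      · obtain ⟨d, hd, hdx, hdr, hdc⟩ := hN.link (c.toFun s)
        refine ⟨d, hd, hdx, hdr, fun h => absurd h hgood, hdc.trans ((hpay ?_).trans ?_)⟩
        · exact (Set.not_disjoint_iff_nonempty_inter.1 hgood).mono
            (inter_subset_inter_left _ (Metric.closedBall_subset_closedBall (by linarith)))
        · exact lintegral_mono fun t => le_add_self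
    have hsplit : ∫⁻ t in Ioc s c.len, (ρ (c.toFun t) + 2 * G (c.toFun t)) =
        ((∫⁻ t in Ioc s s', (ρ (c.toFun t) + G (c.toFun t))) + ∫⁻ t in Ioc s s', G (c.toFun t)) +
          ∫⁻ t in Ioc s' c.len, (ρ (c.toFun t) + 2 * G (c.toFun t)) := by
      rw [← Ioc_union_Ioc_eq_Ioc hs'.1 hs'.2, lintegral_union measurableSet_Ioc
        (Ioc_disjoint_Ioc_of_le le_rfl), ← lintegral_add_right _ hGc]
      simp only [two_mul, add_assoc]
    refine ⟨d, hd, hdx, hdr, fun h => (hdgood h).1, fun p hp => ?_⟩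
    by_cases hexit' : ∃ t ∈ Icc s' c.len, r < dist (c.toFun t) (c.toFun s')
    · obtain ⟨d', hd', hdx', hdr', hdgood', hrest⟩ := ih s' (hs0.trans hs'.1) hs'.2
        (by push_cast at hm; linarith) hexit'
      -- The balls around `c(s)` and `c(s')` cannot both be disjoint from `E` if `d` and `d'` do not
      -- intersect.
      have hpay' : Disjoint d.trace d'.trace →
          N (c.toFun s) ≤ ∫⁻ t in Ioc s s', G (c.toFun t) := fun hdis => by
        refine hpay ?_
        by_contra hempty
        have hfar : Disjoint (Metric.closedBall (c.toFun s) (2 * r)) E :=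
          Set.disjoint_iff_inter_eq_empty.2 (not_nonempty_iff_eq_empty.1 hempty)
        refine hdis.ne_of_mem (hdgood (hfar.mono_left
          (Metric.closedBall_subset_closedBall (by linarith)))).2 (hdgood' (hfar.mono_left ?_)) rfl
        exact Metric.closedBall_subset_closedBall' (by rw [hs'r]; linarith)
      obtain ⟨e, he1, he2, he, hecost⟩ := hN.exists_connection hP hd hdx hdr d'.isContinuum_trace
        (k := ∫⁻ t in Ioc s s', G (c.toFun t))
        ⟨_, d'.source_mem_trace, by
          have := dist_triangle d'.source (c.toFun s') (c.toFun s)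
          have := Metric.mem_closedBall.1 (hdx' d'.source_mem_trace)
          linarith⟩ hdr'
        hpay' hp
      obtain ⟨f, hf1, hf2, hf, hfcost⟩ := hrest _ he2
      refine ⟨e.concat f, by rw [LipPath.source_concat, he1],
        by rwa [LipPath.target_concat hf1.symm],
        hP.mono (LipPath.image_Ico_concat_subset hf1.symm) (hP.union ?_ hf), ?_⟩
      · refine hP.mono ?_ (hP.union he hd')
        rintro _ ⟨t, ht, rfl⟩
        rcases ht.2.eq_or_lt with rfl | h
        · exact Or.inr he2
        · exact Or.inl ⟨t, ⟨ht.1, h⟩, rfl⟩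
      · rw [LipPath.cost_concat hf1.symm, hsplit, add_assoc _ _ η]
        exact add_le_add (hecost.trans (by gcongr)) hfcost
    · push Not at hexit'
      obtain ⟨e, he1, he2, he, hecost⟩ := hN.exists_connection hP hd hdx hdr hF
        (k := η) ⟨c.target, hcF, by
          have h1 := dist_triangle c.target (c.toFun s') (c.toFun s)
          have h2 : dist c.target (c.toFun s') ≤ r := hexit' c.len ⟨hs'.2, le_rfl⟩
          linarith⟩ hFr
        (fun _ => hη _) hp
      refine ⟨e, he1, he2, he, hecost.trans ?_⟩
      rw [hsplit]
      gcongr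
      exact hdcost.trans (le_self_add.trans le_self_add)

/-- A path between two continua can be replaced by a good path whose cost is not much larger. -/
lemma HasLinks.exists_lipPath (hP : IsNegligibleIdeal E P) (hr : 0 < r) (hΛ : 1 ≤ Λ)
    (hρ : Measurable ρ) (hGm : Measurable G)
    (hN : HasLinks P ρ r Λ N) (hη : ∀ x, N x ≤ η)
    (hG : ∀ x y, dist y x ≤ r → (Metric.closedBall x (2 * r) ∩ E).Nonempty →
      N x * ENNReal.ofReal r⁻¹ ≤ G y)
    {F₁ F₂ : Set (EuclideanSpace ℝ (Fin n))} (hF₁ : IsContinuum F₁) (hF₂ : IsContinuum F₂)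
    (hFr₁ : ∃ u ∈ F₁, ∃ v ∈ F₁, r ≤ dist u v) (hFr₂ : ∃ u ∈ F₂, ∃ v ∈ F₂, r ≤ dist u v)
    (hdist : ∀ x ∈ F₁, ∀ y ∈ F₂, r < dist y x) (c : LipPath n) (hc₁ : c.source ∈ F₁)
    (hc₂ : c.target ∈ F₂) :
    ∃ e : LipPath n, e.source ∈ F₁ ∧ e.target ∈ F₂ ∧ P e.inner ∧
      e.cost ρ ≤ c.cost (fun y => ρ y + 2 * G y) + 2 * η := by
  obtain ⟨m, hm⟩ := exists_nat_ge (c.len / r)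
  rw [div_le_iff₀ hr] at hm
  obtain ⟨d, hd, hdx, hdr, -, hrest⟩ := hN.exists_lipPath_aux hP hr hΛ hρ hGm hη hG hF₂ hFr₂ c hc₂ m
    0 le_rfl c.len_nonneg (by simpa using hm)
    ⟨c.len, ⟨c.len_nonneg, le_rfl⟩, hdist _ hc₁ _ hc₂⟩
  by_cases hdis : Disjoint d.trace F₁
  · obtain ⟨b, hb1, hb2, hb, hbN⟩ := hN.join (c.toFun 0) _ _ d.isContinuum_trace hF₁ hdis hdx
      ⟨c.source, hc₁, by
        rw [LipPath.source, dist_self]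
        have : 0 ≤ Λ := by linarith
        positivity⟩ hdr hFr₁
    obtain ⟨e, he1, he2, he, hecost⟩ := hrest _ hb1
    have hcon : b.reverse.target = e.source := by rw [b.target_reverse, he1]
    refine ⟨b.reverse.concat e, ?_, ?_, hP.mono (LipPath.inner_concat_subset hcon)
      (hP.union ?_ he), ?_⟩
    · rwa [LipPath.source_concat, b.source_reverse]
    · rwa [LipPath.target_concat hcon]
    · rw [b.image_Ioc_reverse]
      exact hP.mono (b.image_Ico_subset.trans (insert_subset (Or.inl hb1) subset_union_right))
        (hP.union hd hb)
    · rw [LipPath.cost_concat hcon, b.cost_reverse, two_mul, add_comm, ← add_assoc]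
      exact add_le_add hecost (hbN.trans (hη _))
  · obtain ⟨p, hp1, hp2⟩ := Set.not_disjoint_iff.1 hdis
    obtain ⟨e, he1, he2, he, hecost⟩ := hrest p hp1
    refine ⟨e, by rwa [he1], he2, hP.mono e.inner_subset_image_Ico he, hecost.trans ?_⟩
    rw [two_mul, ← add_assoc]
    exact le_self_add

end

/-! ### Good paths suffice for the modulus -/


lemma measurableSet_dist_lt (s : ℝ) :
    MeasurableSet {p : EuclideanSpace ℝ (Fin n) × EuclideanSpace ℝ (Fin n) | dist p.1 p.2 < s} :=
  (isOpen_lt continuous_dist continuous_const).measurableSet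

lemma measurable_measure_ball (ν : Measure (EuclideanSpace ℝ (Fin n))) [SFinite ν] (s : ℝ) :
    Measurable fun y => ν (Metric.ball y s) := by
  have := measurable_measure_prodMk_left (ν := ν) (measurableSet_dist_lt (n := n) s)
  convert this using 3 with y
  ext z
  simp [dist_comm]

lemma lintegral_measure_ball (ν : Measure (EuclideanSpace ℝ (Fin n))) [SFinite ν] {s : ℝ}
    (hs : 0 < s) :
    ∫⁻ y, ν (Metric.ball y s) = ENNReal.ofReal (s ^ n) *
      volume (Metric.ball (0 : EuclideanSpace ℝ (Fin n)) 1) * ν univ := by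
  have h1 := Measure.prod_apply (μ := (volume : Measure (EuclideanSpace ℝ (Fin n)))) (ν := ν)
    (measurableSet_dist_lt (n := n) s)
  have h2 := Measure.prod_apply_symm (μ := (volume : Measure (EuclideanSpace ℝ (Fin n)))) (ν := ν)
    (measurableSet_dist_lt (n := n) s)
  have e1 : ∀ y : EuclideanSpace ℝ (Fin n), Prod.mk y ⁻¹' {p | dist p.1 p.2 < s} =
      Metric.ball y s := fun y => by ext z; simp [dist_comm]
  have e2 : ∀ y : EuclideanSpace ℝ (Fin n), (fun x => (x, y)) ⁻¹' {p | dist p.1 p.2 < s} =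
      Metric.ball y s := fun y => by ext z; simp
  simp only [e1] at h1
  simp only [e2] at h2
  rw [← h1, h2]
  simp only [volume_ball_eq _ hs, lintegral_const]

lemma rpow_one_div_le_ofReal (hn : n ≠ 0) {X : ℝ≥0∞} {a : ℝ} (ha : 0 ≤ a)
    (h : X ≤ ENNReal.ofReal (a ^ n)) : X ^ (1 / (n : ℝ)) ≤ ENNReal.ofReal a := by
  have hn' : (n : ℝ) ≠ 0 := by exact_mod_cast hn
  calc X ^ (1 / (n : ℝ)) ≤ (ENNReal.ofReal a ^ (n : ℝ)) ^ (1 / (n : ℝ)) := by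
        gcongr
        rwa [ENNReal.rpow_natCast, ← ENNReal.ofReal_pow ha]
    _ = _ := by rw [← ENNReal.rpow_mul, mul_one_div_cancel hn', ENNReal.rpow_one]

section
variable {E : Set (EuclideanSpace ℝ (Fin n))} {P : Set (EuclideanSpace ℝ (Fin n)) → Prop}

/-- If `ρ` is admissible for the good paths, then a perturbation of `ρ` by a function of small
norm is almost admissible for all paths. The perturbation is an `Lⁿ` average of `ρ` over small
balls, restricted to a small neighborhood of `E`; its norm is small because `E` is a null set. -/
lemma HasLoewnerBound.exists_perturbation (hn : 2 ≤ n) (hE : IsClosed E)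
    (hP : IsNegligibleIdeal E P) (hL : HasLoewnerBound P)
    {F₁ F₂ : Set (EuclideanSpace ℝ (Fin n))} (hF₁ : IsContinuum F₁) (hF₂ : IsContinuum F₂)
    (hn₁ : F₁.Nontrivial) (hn₂ : F₂.Nontrivial) (hdisj : Disjoint F₁ F₂)
    {ρ : EuclideanSpace ℝ (Fin n) → ℝ≥0∞} (hρ : LipAdmissible P F₁ F₂ ρ)
    (hfin : ∫⁻ x, ρ x ^ n ≠ ∞) {η : ℝ} (hη : 0 < η) :
    ∃ G : EuclideanSpace ℝ (Fin n) → ℝ≥0∞, Measurable G ∧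
      (∫⁻ x, (2 * G x) ^ n) ^ (1 / (n : ℝ)) ≤ ENNReal.ofReal η ∧
      ∀ c : LipPath n, c.source ∈ F₁ → c.target ∈ F₂ →
        1 ≤ c.cost (fun y => ρ y + 2 * G y) + 2 * ENNReal.ofReal η := by
  have hn0 : n ≠ 0 := by omega
  have hE0 : volume E = 0 := hL.volume_eq_zero hn0 hE hP
  set ω := volume (Metric.ball (0 : EuclideanSpace ℝ (Fin n)) 1) with hω
  have hωt : ω ≠ ∞ := measure_ball_lt_top.ne
  obtain ⟨Λ, hΛ, C₁, hC₁, hlink⟩ := hL.exists_lipPath_trace hn hP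
  obtain ⟨M, hM, C₂, hC₂, hjoin⟩ := hL.exists_lipPath hn (R := Λ + 1) (by linarith)
  have hM0 : 0 < M := by linarith
  set C := max C₁ C₂ with hC
  have hC0 : 0 < C := lt_max_of_lt_left hC₁
  set ν := (volume : Measure (EuclideanSpace ℝ (Fin n))).withDensity (fun x => ρ x ^ n) with hν
  have hνfin : IsFiniteMeasure ν := isFiniteMeasure_withDensity hfin
  have hνE : ν E = 0 := withDensity_absolutelyContinuous _ _ hE0
  -- The scale `r` is chosen small enough for several purposes.
  obtain ⟨δ, hδ, hδint⟩ := exists_pos_setLIntegral_lt_of_measure_lt (μ := volume) hfin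
    (ε := ENNReal.ofReal ((η / C) ^ n)) (by simp; positivity)
  have hsmall : ∀ᶠ r in nhdsWithin (0 : ℝ) (Ioi 0), ENNReal.ofReal ((M * r) ^ n) * ω < δ := by
    have h1 : Filter.Tendsto (fun r : ℝ => ENNReal.ofReal ((M * r) ^ n) * ω) (nhds 0)
        (nhds (ENNReal.ofReal ((M * 0) ^ n) * ω)) :=
      ENNReal.Tendsto.mul_const (ENNReal.tendsto_ofReal (Continuous.tendsto (by fun_prop) 0))
        (Or.inr hωt)
    rw [mul_zero, zero_pow hn0, ENNReal.ofReal_zero, zero_mul] at h1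
    exact (h1.mono_left nhdsWithin_le_nhds).eventually (gt_mem_nhds hδ)
  set κ : ℝ≥0∞ := ENNReal.ofReal ((2 * C) ^ n) * (ENNReal.ofReal ((M + 1) ^ n) * ω) with hκ
  have hκt : κ ≠ ∞ := ENNReal.mul_ne_top ENNReal.ofReal_ne_top
    (ENNReal.mul_ne_top ENNReal.ofReal_ne_top hωt)
  have hnbhd : ∀ᶠ r in nhdsWithin (0 : ℝ) (Ioi 0),
      κ * ν (Metric.thickening ((M + 2) * r) E) < ENNReal.ofReal (η ^ n) := by
    have h1 := tendsto_measure_thickening_of_isClosed (μ := ν) (s := E)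
      ⟨1, one_pos, measure_ne_top _ _⟩ hE
    have h2 : Filter.Tendsto (fun r : ℝ => (M + 2) * r) (nhdsWithin 0 (Ioi 0))
        (nhdsWithin 0 (Ioi 0)) := by
      refine tendsto_nhdsWithin_iff.2 ⟨?_, ?_⟩
      · have : Filter.Tendsto (fun r : ℝ => (M + 2) * r) (nhds 0) (nhds ((M + 2) * 0)) :=
          Continuous.tendsto (by fun_prop) 0
        rw [mul_zero] at this
        exact this.mono_left nhdsWithin_le_nhds
      · filter_upwards [self_mem_nhdsWithin] with r hr
        exact mul_pos (by linarith) (mem_Ioi.1 hr)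
    have h3 := ENNReal.Tendsto.const_mul (h1.comp h2) (Or.inr hκt)
    rw [hνE, mul_zero] at h3
    exact h3.eventually (gt_mem_nhds (ENNReal.ofReal_pos.2 (by positivity)))
  obtain ⟨d₀, hd₀, hd₀F⟩ : ∃ d₀ > 0, ∀ x ∈ F₁, ∀ y ∈ F₂, d₀ < dist y x := by
    obtain ⟨a, ha, h⟩ := Metric.exists_pos_forall_lt_edist hF₁.1 hF₂.1.isClosed hdisj
    refine ⟨a, ha, fun x hx y hy => ?_⟩
    have := h x hx y hy
    rw [edist_comm, edist_nndist] at this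
    exact_mod_cast this
  obtain ⟨u₁, hu₁, v₁, hv₁, huv₁⟩ := hn₁
  obtain ⟨u₂, hu₂, v₂, hv₂, huv₂⟩ := hn₂
  have hlt : ∀ {b : ℝ}, 0 < b → ∀ᶠ r in nhdsWithin (0 : ℝ) (Ioi 0), r < b := fun hb =>
    (gt_mem_nhds hb).filter_mono nhdsWithin_le_nhds
  obtain ⟨r, hr, hrδ, hrκ, hrd, hr₁, hr₂⟩ :=
    ((eventually_mem_nhdsWithin (a := (0 : ℝ)) (s := Ioi 0)).and
    (hsmall.and (hnbhd.and ((hlt hd₀).and ((hlt (dist_pos.2 huv₁)).and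
      (hlt (dist_pos.2 huv₂))))))).exists
  replace hr : 0 < r := hr
  set N : EuclideanSpace ℝ (Fin n) → ℝ≥0∞ :=
    fun x => ENNReal.ofReal C * localNorm ρ x (M * r) with hN
  set U := Metric.thickening ((M + 2) * r) E with hU
  have hUm : MeasurableSet U := Metric.isOpen_thickening.measurableSet
  set G : EuclideanSpace ℝ (Fin n) → ℝ≥0∞ := fun y =>
    ENNReal.ofReal (C / r) * ((ν.restrict U) (Metric.ball y ((M + 1) * r))) ^ (1 / (n : ℝ)) with hG
  have hGm : Measurable G :=
    ((measurable_measure_ball (ν.restrict U) ((M + 1) * r)).pow_const _).const_mul _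
  have hlinks : HasLinks P ρ r Λ N := by
    constructor
    · intro x
      obtain ⟨c, hc, hcx, hcr, hcost⟩ := hlink ρ hρ.1 x r hr
      refine ⟨c, hc, hcx.trans Metric.ball_subset_closedBall, hcr, hcost.trans ?_⟩
      refine mul_le_mul' (ENNReal.ofReal_le_ofReal (le_max_left _ _))
        (localNorm_mono ρ (Metric.ball_subset_ball ?_))
      exact mul_le_mul_of_nonneg_right (by linarith) hr.le
    · intro x K₁ K₂ h₁ h₂ h hx₁ hx₂ hr₁ hr₂
      obtain ⟨c, hc1, hc2, hc, -, hcost⟩ := hjoin ρ hρ.1 x r hr K₁ K₂ h₁ h₂ h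
        (hx₁.trans (Metric.closedBall_subset_closedBall (by nlinarith))) hx₂ hr₁ hr₂
      refine ⟨c, hc1, hc2, hc, hcost.trans ?_⟩
      exact mul_le_mul' (ENNReal.ofReal_le_ofReal (le_max_right _ _)) le_rfl
  have hNη : ∀ x, N x ≤ ENNReal.ofReal η := fun x => by
    have h1 : localNorm ρ x (M * r) ≤ ENNReal.ofReal (η / C) :=
      rpow_one_div_le_ofReal hn0 (by positivity)
        (hδint _ (by rwa [volume_ball_eq x (by positivity)])).le
    calc N x ≤ ENNReal.ofReal C * ENNReal.ofReal (η / C) := mul_le_mul_right h1 _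
      _ = ENNReal.ofReal η := by
        rw [← ENNReal.ofReal_mul hC0.le, mul_div_cancel₀ _ hC0.ne']
  have hNG : ∀ x y, dist y x ≤ r → (Metric.closedBall x (2 * r) ∩ E).Nonempty →
      N x * ENNReal.ofReal r⁻¹ ≤ G y := by
    rintro x y hyx ⟨z, hzx, hzE⟩
    have h1 : Metric.ball x (M * r) ⊆ Metric.ball y ((M + 1) * r) :=
      Metric.ball_subset_ball' (by rw [dist_comm]; linarith)
    have h2 : Metric.ball x (M * r) ⊆ U := fun w hw => by
      refine Metric.mem_thickening_iff.2 ⟨z, hzE, ?_⟩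
      have := dist_triangle_right w z x
      rw [Metric.mem_closedBall] at hzx
      rw [Metric.mem_ball] at hw
      linarith
    rw [hN, hG, div_eq_mul_inv, ENNReal.ofReal_mul hC0.le]
    simp only
    rw [mul_right_comm]
    refine mul_le_mul_right (ENNReal.rpow_le_rpow ?_ (by positivity)) _
    calc ∫⁻ w in Metric.ball x (M * r), ρ w ^ n = ν (Metric.ball x (M * r)) :=
          (withDensity_apply _ Metric.isOpen_ball.measurableSet).symm
      _ ≤ ν (Metric.ball y ((M + 1) * r) ∩ U) := measure_mono (subset_inter h1 h2)
      _ = _ := (Measure.restrict_apply Metric.isOpen_ball.measurableSet).symm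
  refine ⟨G, hGm, rpow_one_div_le_ofReal hn0 hη.le (le_trans (le_of_eq ?_) hrκ.le),
    fun c hc1 hc2 => ?_⟩
  · have h1 : ∀ y, (2 * G y) ^ n = ENNReal.ofReal ((2 * C / r) ^ n) *
        (ν.restrict U) (Metric.ball y ((M + 1) * r)) := fun y => by
      have hn' : (n : ℝ) ≠ 0 := by exact_mod_cast hn0
      rw [hG, ← mul_assoc, mul_pow, ← ENNReal.rpow_natCast (_ ^ (1 / (n : ℝ))),
        ← ENNReal.rpow_mul, one_div_mul_cancel hn', ENNReal.rpow_one,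
        ENNReal.ofReal_pow (by positivity), mul_div_assoc, ENNReal.ofReal_mul zero_le_two,
        ENNReal.ofReal_ofNat]
    simp only [h1]
    rw [lintegral_const_mul _ (measurable_measure_ball _ _),
      lintegral_measure_ball _ (by positivity), Measure.restrict_apply_univ, hκ,
      ← mul_assoc, ← mul_assoc, ← mul_assoc, ← ENNReal.ofReal_mul (by positivity),
      ← ENNReal.ofReal_mul (by positivity), ← mul_pow, ← mul_pow]
    congr 4
    field_simp
  · obtain ⟨e, he1, he2, he, hecost⟩ := hlinks.exists_lipPath hP hr hΛ hρ.1 hGm hNη hNG hF₁ hF₂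
      ⟨u₁, hu₁, v₁, hv₁, hr₁.le⟩ ⟨u₂, hu₂, v₂, hv₂, hr₂.le⟩
      (fun x hx y hy => hrd.trans (hd₀F x hx y hy)) c hc1 hc2
    exact (hρ.2 e he1 he2 he).trans hecost

/-- A Loewner-type bound for the good paths implies that all paths joining two continua have the
same modulus as the good ones. -/
theorem HasLoewnerBound.lipModulus_eq (hE : IsClosed E) (hP : IsNegligibleIdeal E P)
    (hL : HasLoewnerBound P) {F₁ F₂ : Set (EuclideanSpace ℝ (Fin n))} (hF₁ : IsContinuum F₁)
    (hF₂ : IsContinuum F₂) (hdisj : Disjoint F₁ F₂) :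
    lipModulus (fun _ => True) F₁ F₂ = lipModulus P F₁ F₂ := by
  refine le_antisymm ?_ (le_iInf₂ fun ρ hρ =>
    LipAdmissible.lipModulus_le ⟨hρ.1, fun c h1 h2 _ => hρ.2 c h1 h2 trivial⟩)
  rcases Nat.lt_or_ge n 2 with hn | hn
  · interval_cases n
    · obtain ⟨x, hx⟩ := hF₁.2.nonempty
      obtain ⟨y, hy⟩ := hF₂.2.nonempty
      exact absurd (Subsingleton.elim x y) (hdisj.ne_of_mem hx hy)
    · exact lipModulus_le_of_dim_one rfl hP hL hdisj
  by_cases hdeg : F₁.Subsingleton ∨ F₂.Subsingleton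
  · rw [lipModulus_eq_zero_of_subsingleton hn _ hF₁ hF₂ hdisj hdeg]
    exact zero_le
  simp only [not_or, not_subsingleton_iff] at hdeg
  have hn0 : n ≠ 0 := by omega
  have hn1 : (1 : ℝ) ≤ n := by exact_mod_cast (by omega : 1 ≤ n)
  have hn' : (n : ℝ) ≠ 0 := by linarith
  refine le_iInf₂ fun ρ hρ => ?_
  rcases eq_or_ne (∫⁻ x, ρ x ^ n) ∞ with hfin | hfin
  · rw [hfin]; exact le_top
  set m := lipModulus (fun _ => True) F₁ F₂
  set I := ∫⁻ x, ρ x ^ n with hI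
  -- The claim up to an error `η`, for the `n`-th roots.
  have key : ∀ η : ℝ, 0 < η → η < 1 / 2 → m ^ (1 / (n : ℝ)) ≤
      ENNReal.ofReal (1 - 2 * η)⁻¹ * (I ^ (1 / (n : ℝ)) + ENNReal.ofReal η) := by
    intro η hη hη2
    obtain ⟨G, hGm, hGn, hG⟩ := hL.exists_perturbation hn hE hP hF₁ hF₂ hdeg.1 hdeg.2 hdisj hρ
      hfin hη
    have h2G : Measurable fun y => 2 * G y := hGm.const_mul _
    set k := ENNReal.ofReal (1 - 2 * η)⁻¹ with hk
    have hsum : Measurable fun y => ρ y + 2 * G y := hρ.1.add h2G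
    have hadm : LipAdmissible (fun _ => True) F₁ F₂ fun y => k * (ρ y + 2 * G y) := by
      refine ⟨hsum.const_mul _, fun c hc1 hc2 _ => ?_⟩
      have hm : Measurable fun t => ρ (c.toFun t) + 2 * G (c.toFun t) :=
        hsum.comp c.lip.continuous.measurable
      rw [LipPath.cost, lintegral_const_mul _ hm]
      have h1 : ENNReal.ofReal (1 - 2 * η) ≤ c.cost (fun y => ρ y + 2 * G y) := by
        rw [ENNReal.ofReal_sub _ (by positivity), ENNReal.ofReal_one,
          ENNReal.ofReal_mul zero_le_two, ENNReal.ofReal_ofNat]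
        exact tsub_le_iff_right.2 (hG c hc1 hc2)
      calc (1 : ℝ≥0∞) = k * ENNReal.ofReal (1 - 2 * η) := by
            rw [hk, ← ENNReal.ofReal_mul (inv_nonneg.2 (by linarith)),
              inv_mul_cancel₀ (by linarith), ENNReal.ofReal_one]
        _ ≤ _ := mul_le_mul_right h1 _
    calc m ^ (1 / (n : ℝ)) ≤ (∫⁻ y, (k * (ρ y + 2 * G y)) ^ n) ^ (1 / (n : ℝ)) :=
          ENNReal.rpow_le_rpow hadm.lipModulus_le (by positivity)
      _ = k * (∫⁻ y, (ρ y + 2 * G y) ^ n) ^ (1 / (n : ℝ)) := by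
          simp only [mul_pow]
          rw [lintegral_const_mul _ (hsum.pow_const n), ENNReal.mul_rpow_of_nonneg _ _
            (by positivity), ← ENNReal.rpow_natCast, ← ENNReal.rpow_mul,
            mul_one_div_cancel hn', ENNReal.rpow_one]
      _ ≤ k * (I ^ (1 / (n : ℝ)) + ENNReal.ofReal η) := by
          gcongr
          have := ENNReal.lintegral_Lp_add_le (μ := volume) hρ.1.aemeasurable h2G.aemeasurable hn1
          simp only [Pi.add_apply, ENNReal.rpow_natCast] at this
          exact this.trans (add_le_add le_rfl hGn)
  have hlim : Filter.Tendsto (fun η : ℝ => ENNReal.ofReal (1 - 2 * η)⁻¹ *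
      (I ^ (1 / (n : ℝ)) + ENNReal.ofReal η)) (nhdsWithin 0 (Ioi 0))
      (nhds (I ^ (1 / (n : ℝ)))) := by
    have h1 : Filter.Tendsto (fun η : ℝ => ENNReal.ofReal (1 - 2 * η)⁻¹) (nhds 0)
        (nhds 1) := by
      have : Filter.Tendsto (fun η : ℝ => (1 - 2 * η)⁻¹) (nhds 0) (nhds (1 - 2 * 0)⁻¹) :=
        (Continuous.tendsto (by fun_prop) 0).inv₀ (by norm_num)
      simpa using ENNReal.tendsto_ofReal this
    have h2 : Filter.Tendsto (fun η : ℝ => I ^ (1 / (n : ℝ)) + ENNReal.ofReal η) (nhds 0)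
        (nhds (I ^ (1 / (n : ℝ)))) := by
      simpa using tendsto_const_nhds.add (ENNReal.tendsto_ofReal
        (continuous_id.tendsto (0 : ℝ)))
    have h3 := ENNReal.Tendsto.mul h1 (Or.inl one_ne_zero) h2 (Or.inr ENNReal.one_ne_top)
    rw [one_mul] at h3
    exact h3.mono_left nhdsWithin_le_nhds
  have hroot : m ^ (1 / (n : ℝ)) ≤ I ^ (1 / (n : ℝ)) := by
    refine ge_of_tendsto hlim ?_
    filter_upwards [self_mem_nhdsWithin,
      (gt_mem_nhds (show (0 : ℝ) < 1 / 2 by norm_num)).filter_mono nhdsWithin_le_nhds]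
      with η hη hη2 using key η hη hη2
  exact (ENNReal.rpow_le_rpow_iff (by positivity)).1 hroot

/-- The Loewner property in the form of `HasLoewnerBound`. -/
lemma hasLoewnerBound_true : HasLoewnerBound (n := n) fun _ => True := by
  intro t ht
  rcases eq_or_ne n 0 with rfl | hn
  · exact ⟨1, one_pos, fun F₁ F₂ _ _ h _ _ _ =>
      absurd (subsingleton_of_subsingleton (s := F₁)) h.not_subsingleton⟩
  · obtain ⟨φ, hφ, h⟩ := loewner hn ht
    exact ⟨φ, hφ, fun F₁ F₂ h₁ h₂ hn₁ hn₂ _ => h F₁ F₂ h₁ h₂ hn₁ hn₂⟩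

/-- The good paths have the same modulus as all paths if and only if they satisfy a Loewner-type
bound. -/
theorem forall_lipModulus_eq_iff (hE : IsClosed E) (hP : IsNegligibleIdeal E P) :
    (∀ F₁ F₂ : Set (EuclideanSpace ℝ (Fin n)), IsContinuum F₁ → IsContinuum F₂ → Disjoint F₁ F₂ →
      lipModulus (fun _ => True) F₁ F₂ = lipModulus P F₁ F₂) ↔
    ∃ φ : ℝ → ℝ, (∀ t : ℝ, 0 < t → 0 < φ t) ∧
      ∀ t : ℝ, 0 < t → ∀ F₁ F₂ : Set (EuclideanSpace ℝ (Fin n)),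
        IsContinuum F₁ → IsContinuum F₂ → F₁.Nontrivial → F₂.Nontrivial → Disjoint F₁ F₂ →
        relativeDistance F₁ F₂ ≤ t → ENNReal.ofReal (φ t) ≤ lipModulus P F₁ F₂ := by
  constructor
  · intro h
    choose! φ hφ hmod using hasLoewnerBound_true (n := n)
    refine ⟨φ, hφ, fun t ht F₁ F₂ h₁ h₂ hn₁ hn₂ hd hrel => ?_⟩
    rw [← h F₁ F₂ h₁ h₂ hd]
    exact hmod t ht F₁ F₂ h₁ h₂ hn₁ hn₂ hd hrel
  · rintro ⟨φ, hφ, h⟩ F₁ F₂ h₁ h₂ hd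
    have hL : HasLoewnerBound P := fun t ht => ⟨φ t, hφ t ht, h t ht⟩
    exact hL.lipModulus_eq hE hP h₁ h₂ hd

end

end ExtremalDistance

theorem theorem1p10 (n : ℕ) (E : Set (EuclideanSpace ℝ (Fin n))) (hE : IsClosed E) :
    (ExtremalDistance.NED E ↔
      ∃ φ : ℝ → ℝ, (∀ t : ℝ, 0 < t → 0 < φ t) ∧
        ∀ t : ℝ, 0 < t → ∀ F₁ F₂ : Set (EuclideanSpace ℝ (Fin n)),
          ExtremalDistance.IsContinuum F₁ → ExtremalDistance.IsContinuum F₂ →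
          F₁.Nontrivial → F₂.Nontrivial → Disjoint F₁ F₂ →
          ExtremalDistance.relativeDistance F₁ F₂ ≤ t →
          ENNReal.ofReal (φ t) ≤
            ExtremalDistance.modulus
              (ExtremalDistance.joining F₁ F₂ Set.univ ∩ ExtremalDistance.avoiding E)) ∧
    (ExtremalDistance.CNED E ↔
      ∃ φ : ℝ → ℝ, (∀ t : ℝ, 0 < t → 0 < φ t) ∧
        ∀ t : ℝ, 0 < t → ∀ F₁ F₂ : Set (EuclideanSpace ℝ (Fin n)),
          ExtremalDistance.IsContinuum F₁ → ExtremalDistance.IsContinuum F₂ →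
          F₁.Nontrivial → F₂.Nontrivial → Disjoint F₁ F₂ →
          ExtremalDistance.relativeDistance F₁ F₂ ≤ t →
          ENNReal.ofReal (φ t) ≤
            ExtremalDistance.modulus
              (ExtremalDistance.joining F₁ F₂ Set.univ ∩ ExtremalDistance.meetingCountably E)) := by
  open ExtremalDistance in
  constructor
  · convert forall_lipModulus_eq_iff hE (isNegligibleIdeal_disjoint E) using 1
    · refine forall₅_congr fun F₁ F₂ _ _ hd => ?_
      rw [modulus_joining hd, modulus_joining_avoiding hd]
    · refine exists_congr fun φ => and_congr_right fun _ =>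
        forall₃_congr fun t _ F₁ => forall₅_congr fun F₂ _ _ _ _ => forall₂_congr fun hd _ => ?_
      rw [modulus_joining_avoiding hd]
  · convert forall_lipModulus_eq_iff hE (isNegligibleIdeal_countable E) using 1
    · refine forall₅_congr fun F₁ F₂ _ _ hd => ?_
      rw [modulus_joining hd, modulus_joining_meetingCountably hd]
    · refine exists_congr fun φ => and_congr_right fun _ =>
        forall₃_congr fun t _ F₁ => forall₅_congr fun F₂ _ _ _ _ => forall₂_congr fun hd _ => ?_
      rw [modulus_joining_meetingCountably hd]
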